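/- **Model.** A (quantum, input-free, interactive) protocol between Alice and Bob uses finite-dimensional registers $A$ (Alice), $M$ (messages), $B$ (Bob), each starting in a fixed basis state. In each of finitely many rounds, first Alice applies a quantum channel (given by Kraus operators) to $A\otimes M$, then Bob applies a quantum channel to $B\otimes M$. At the end each party measures its private register in the computational basis and reads its output off the result; "Abort" is a possible output. A dishonest party may use an arbitrary finite-dimensional private register and arbitrary channels on it and $M$, and holds $M$ at the end as well. **$\mathrm{OT}_p^{\otimes n}$.** For $n\in\mathbb N$, an $\mathrm{OT}_p^{\otimes n}$ protocol is a protocol in which Alice outputs $(z_0,z_1)\in\{0,1\}^n\times\{0,1\}^n$ or Abort, Bob outputs $(b,w)\in\{0,1\}^n\times\{0,1\}^n$ or Abort, and such that, if both are honest, nobody aborts, $(z_0,z_1)$ is uniform, $b$ is uniform, and $w=z_b$ with probability $p$, where $(z_b)_i:=(z_{b_i})_i$. $\mathrm{OT}_p$ is the case $n=1$. **Security.** The protocol is *secure* if (i) for every dishonest Alice interacting with honest Bob, the unnormalized final state of Alice's systems on the event that Bob does not abort and outputs index $b$ is the same for all $b\in\{0,1\}^n$, and (ii) for every dishonest Bob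 interacting with honest Alice, the unnormalized final state of Bob's systems on the event that Alice does not abort and $z_0\oplus z_1=x$ is the same for all $x\in\{0,1\}^n$. That is, unless the honest party aborts, the dishonest one has no information about $b$, respectively $z_0\oplus z_1$. It is *weakly secure* if (i) and (ii) hold for those dishonest strategies for which the honest party aborts with probability $0$. Every secure protocol is weakly secure. **Theorem (perfect parallel repetition of secure OT).** Let $n\in\mathbb N$. 1. Every weakly secure (in particular, every secure) $\mathrm{OT}_p^{\otimes n}$ protocol satisfies $p\le(\cos^2(\pi/8))^n$. 2. There is a secure $\mathrm{OT}_{\cos^2(\pi/8)}$ protocol. 3. If $P$ is any secure $\mathrm{OT}_{\cos^2(\pi/8)}$ protocol, then $n$ independent copies of $P$ executed in parallel (aborting as soon as one copy is aborted) form a secure $\mathrm{OT}_p^{\otimes n}$ protocol with $p=(\cos^2(\pi/8))^n$. Hence the bound in 1 is attained by $n$ independent secure OT protocols. -/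

import Mathlib

namespace QOT

open scoped Matrix

/-- A quantum channel on the finite-dimensional space with orthonormal basis `X`, given by
Kraus operators. -/
structure Channel (X : Type) [Fintype X] [DecidableEq X] where
  /-- index set of the Kraus operators -/
  κ : Type
  [fintypeκ : Fintype κ]
  /-- the Kraus operators -/
  op : κ → Matrix X X ℂ
  trace_preserving : ∑ k, (op k)ᴴ * op k = 1

attribute [instance] Channel.fintypeκ

/-- What one party does in an interaction over the message space with basis `M`: a private space
with basis `S`, an initial basis state, and for each round a channel on private space and message
space. -/
structure Strategy (M : Type) [Fintype M] [DecidableEq M] where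
  S : Type
  [fintypeS : Fintype S]
  [decEqS : DecidableEq S]
  init : S
  move : ℕ → Channel (S × M)

attribute [instance] Strategy.fintypeS Strategy.decEqS

section Run

variable {A M B : Type} [Fintype A] [DecidableEq A] [Fintype M] [DecidableEq M]
  [Fintype B] [DecidableEq B]

/-- The operator `K` on Alice's and the message register, tensored with the identity of Bob's. -/
def onAlice (K : Matrix (A × M) (A × M) ℂ) : Matrix (A × M × B) (A × M × B) ℂ :=
  Matrix.of fun x y => if x.2.2 = y.2.2 then K (x.1, x.2.1) (y.1, y.2.1) else 0

/-- The operator `K` on Bob's and the message register, tensored with the identity of Alice's. -/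
def onBob (K : Matrix (B × M) (B × M) ℂ) : Matrix (A × M × B) (A × M × B) ℂ :=
  Matrix.of fun x y => if x.1 = y.1 then K (x.2.2, x.2.1) (y.2.2, y.2.1) else 0

/-- Alice applies a channel to her private register and the message register. -/
def aliceStep (C : Channel (A × M)) (ρ : Matrix (A × M × B) (A × M × B) ℂ) :
    Matrix (A × M × B) (A × M × B) ℂ :=
  ∑ k, onAlice (C.op k) * ρ * (onAlice (C.op k))ᴴ

/-- Bob applies a channel to his private register and the message register. -/
def bobStep (C : Channel (B × M)) (ρ : Matrix (A × M × B) (A × M × B) ℂ) :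
    Matrix (A × M × B) (A × M × B) ℂ :=
  ∑ k, onBob (C.op k) * ρ * (onBob (C.op k))ᴴ

end Run

/-- The joint density matrix after `t` rounds, when Alice follows `α`, Bob follows `β`, and the
message register starts in the basis state `m₀`.  In each round Alice moves first, then Bob. -/
def jointState {M : Type} [Fintype M] [DecidableEq M] (m₀ : M) (α β : Strategy M) :
    ℕ → Matrix (α.S × M × β.S) (α.S × M × β.S) ℂ
  | 0 => Matrix.single (α.init, m₀, β.init) (α.init, m₀, β.init) 1
  | t + 1 => bobStep (β.move t) (aliceStep (α.move t) (jointState m₀ α β t))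

/-- The probability that a measurement of `ρ` in the basis `X` gives an outcome in `E`. -/
noncomputable def prob {X : Type} [Fintype X] (ρ : Matrix X X ℂ) (E : Set X) : ℝ :=
  ∑ x, E.indicator (fun x => (ρ x x).re) x

/-- Strings of `n` bits. -/
abbrev Bits (n : ℕ) : Type := Fin n → Bool

/-- The string `z_b`, whose `i`-th bit is the `i`-th bit of `z₀` if `b i = 0` and of `z₁` if
`b i = 1`. -/
def select {n : ℕ} (z : Bits n × Bits n) (b : Bits n) : Bits n :=
  fun i => if b i then z.2 i else z.1 i

/-- The bitwise XOR of the two strings of a pair. -/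
def xorBits {n : ℕ} (z : Bits n × Bits n) : Bits n := fun i => xor (z.1 i) (z.2 i)

/-- A quantum interactive protocol without inputs between Alice and Bob.  After the last round
each party measures its private register in the basis and reads its output off the result.
Alice outputs `(z₀, z₁)`, Bob outputs `(b, w)`, and `none` stands for Abort. -/
structure Protocol (n : ℕ) where
  rounds : ℕ
  M : Type
  [fintypeM : Fintype M]
  [decEqM : DecidableEq M]
  m₀ : M
  alice : Strategy M
  bob : Strategy M
  aliceOut : alice.S → Option (Bits n × Bits n)
  bobOut : bob.S → Option (Bits n × Bits n)

attribute [instance] Protocol.fintypeM Protocol.decEqM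

namespace Protocol

variable {n : ℕ}

/-- Final joint state when Alice follows `α` and Bob follows `β`. -/
def final (P : Protocol n) (α β : Strategy P.M) :
    Matrix (α.S × P.M × β.S) (α.S × P.M × β.S) ℂ :=
  jointState P.m₀ α β P.rounds

/-- `P` is an `n`-fold repetition of oblivious transfer with correctness `p`: when both parties
are honest, nobody aborts, the pair `(z₀, z₁)` is uniform, the string `b` is uniform, and
`w = z_b` with probability `p`. -/
structure IsOT (P : Protocol n) (p : ℝ) : Prop where
  alice_no_abort :
    prob (P.final P.alice P.bob) {x | P.aliceOut x.1 = none} = 0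
  bob_no_abort :
    prob (P.final P.alice P.bob) {x | P.bobOut x.2.2 = none} = 0
  alice_uniform : ∀ z : Bits n × Bits n,
    prob (P.final P.alice P.bob) {x | P.aliceOut x.1 = some z} = (1 / 2) ^ (2 * n)
  bob_uniform : ∀ b : Bits n,
    prob (P.final P.alice P.bob) {x | ∃ w, P.bobOut x.2.2 = some (b, w)} = (1 / 2) ^ n
  correct :
    prob (P.final P.alice P.bob)
      {x | ∃ z b, P.aliceOut x.1 = some z ∧ P.bobOut x.2.2 = some (b, select z b)} = p

/-- Dishonest Alice follows `α` against honest Bob.  This is the state of all that she holds at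
the end (private and message register), restricted to the event that Bob does not abort and
outputs the index string `b`; its trace is the probability of that event. -/
def aliceView (P : Protocol n) (α : Strategy P.M) (b : Bits n) :
    Matrix (α.S × P.M) (α.S × P.M) ℂ :=
  Matrix.of fun u v => ∑ s ∈ {s : P.bob.S | (P.bobOut s).map Prod.fst = some b},
    P.final α P.bob (u.1, u.2, s) (v.1, v.2, s)

/-- Dishonest Bob follows `β` against honest Alice.  This is the state of all that he holds at
the end (private and message register), restricted to the event that Alice does not abort and
outputs strings with XOR `x`; its trace is the probability of that event. -/
def bobView (P : Protocol n) (β : Strategy P.M) (x : Bits n) :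
    Matrix (β.S × P.M) (β.S × P.M) ℂ :=
  Matrix.of fun u v => ∑ s ∈ {s : P.alice.S | (P.aliceOut s).map xorBits = some x},
    P.final P.alice β (s, u.2, u.1) (s, v.2, v.1)

/-- Security: whatever a dishonest party does, given that the other (honest) party does not
abort, the dishonest party has no information about `b` (if it is Alice), respectively about
`z₀ ⊕ z₁` (if it is Bob): this string is uniform and independent of everything that the
dishonest party holds. -/
structure IsSecure (P : Protocol n) : Prop where
  against_alice : ∀ (α : Strategy P.M) (b b' : Bits n), P.aliceView α b = P.aliceView α b'
  against_bob : ∀ (β : Strategy P.M) (x x' : Bits n), P.bobView β x = P.bobView β x'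

/-- A weaker form of security: only those dishonest strategies are considered that never make
the honest party abort. -/
structure IsWeaklySecure (P : Protocol n) : Prop where
  against_alice : ∀ α : Strategy P.M,
    prob (P.final α P.bob) {x | P.bobOut x.2.2 = none} = 0 →
      ∀ b b' : Bits n, P.aliceView α b = P.aliceView α b'
  against_bob : ∀ β : Strategy P.M,
    prob (P.final P.alice β) {x | P.aliceOut x.1 = none} = 0 →
      ∀ x x' : Bits n, P.bobView β x = P.bobView β x'

theorem IsSecure.isWeaklySecure {P : Protocol n} (h : P.IsSecure) : P.IsWeaklySecure :=
  ⟨fun α _ => h.against_alice α, fun β _ => h.against_bob β⟩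

end Protocol

/-- The `n`-fold tensor product of the operators `K (k 0), K (k 1), …`. -/
def tensorOp {S M κ : Type} (K : κ → Matrix (S × M) (S × M) ℂ) {n : ℕ} (k : Fin n → κ) :
    Matrix ((Fin n → S) × (Fin n → M)) ((Fin n → S) × (Fin n → M)) ℂ :=
  Matrix.of fun x y => ∏ i, K (k i) (x.1 i, x.2 i) (y.1 i, y.2 i)

theorem tensorOp_trace_preserving {S M κ : Type} [Fintype S] [DecidableEq S] [Fintype M]
    [DecidableEq M] [Fintype κ] (K : κ → Matrix (S × M) (S × M) ℂ)
    (hK : ∑ k, (K k)ᴴ * K k = 1) (n : ℕ) :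
    ∑ k : Fin n → κ, (tensorOp K k)ᴴ * tensorOp K k = 1 := by
  have h1 : ∀ x y : S × M, ∑ k, ∑ z, star (K k z x) * K k z y = if x = y then 1 else 0 := by
    intro x y
    have := congrFun (congrFun hK x) y
    rw [Matrix.one_apply, Matrix.sum_apply] at this
    simpa [Matrix.mul_apply, Matrix.conjTranspose_apply] using this
  ext x y
  rw [Matrix.sum_apply, Matrix.one_apply]
  simp only [Matrix.mul_apply, Matrix.conjTranspose_apply, tensorOp, Matrix.of_apply, star_prod,
    ← Finset.prod_mul_distrib]
  let e : (Fin n → S × M) ≃ (Fin n → S) × (Fin n → M) := Equiv.arrowProdEquivProdArrow _ _ _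
  have h2 : ∀ k : Fin n → κ,
      ∑ z : (Fin n → S) × (Fin n → M), ∏ i, (star (K (k i) (z.1 i, z.2 i) (x.1 i, x.2 i)) *
        K (k i) (z.1 i, z.2 i) (y.1 i, y.2 i)) =
      ∏ i, ∑ z : S × M, (star (K (k i) z (x.1 i, x.2 i)) * K (k i) z (y.1 i, y.2 i)) := by
    intro k
    rw [Finset.prod_univ_sum, Fintype.piFinset_univ, ← e.sum_comp]
    rfl
  simp only [h2]
  rw [← Fintype.piFinset_univ, ← Finset.prod_univ_sum
    (fun _ => Finset.univ) (fun i k => ∑ z : S × M, (star (K k z (x.1 i, x.2 i)) *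
        K k z (y.1 i, y.2 i)))]
  simp only [h1]
  by_cases h : x = y
  · subst h; simp
  · rw [if_neg h]
    have : ∃ i, (x.1 i, x.2 i) ≠ (y.1 i, y.2 i) := by
      by_contra hc
      push Not at hc
      apply h
      ext i
      · exact congrArg Prod.fst (hc i)
      · exact congrArg Prod.snd (hc i)
    obtain ⟨i, hi⟩ := this
    exact Finset.prod_eq_zero (Finset.mem_univ i) (if_neg hi)

/-- The tensor power of a channel: `n` independent applications in parallel. -/
def Channel.pow {S M : Type} [Fintype S] [DecidableEq S] [Fintype M] [DecidableEq M]
    (C : Channel (S × M)) (n : ℕ) : Channel ((Fin n → S) × (Fin n → M)) where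
  κ := Fin n → C.κ
  op k := tensorOp C.op k
  trace_preserving := tensorOp_trace_preserving C.op C.trace_preserving n

/-- `n` independent copies of a strategy, played in parallel. -/
def Strategy.pow {M : Type} [Fintype M] [DecidableEq M] (σ : Strategy M) (n : ℕ) :
    Strategy (Fin n → M) where
  S := Fin n → σ.S
  init := fun _ => σ.init
  move t := (σ.move t).pow n

/-- Collects the outputs of `n` copies of a protocol for single bits; it is Abort as soon as one
of the copies is aborted. -/
def collect {n : ℕ} (o : Fin n → Option (Bits 1 × Bits 1)) : Option (Bits n × Bits n) :=
  if h : ∀ i, (o i).isSome then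
    some (fun i => ((o i).get (h i)).1 0, fun i => ((o i).get (h i)).2 0)
  else none

/-- `n` independent copies of a protocol for single bits, executed in parallel by honest
parties. -/
def Protocol.pow (P : Protocol 1) (n : ℕ) : Protocol n where
  rounds := P.rounds
  M := Fin n → P.M
  m₀ := fun _ => P.m₀
  alice := P.alice.pow n
  bob := P.bob.pow n
  aliceOut := fun s => collect fun i => P.aliceOut (s i)
  bobOut := fun s => collect fun i => P.bobOut (s i)

end QOT

/-! Upper bound. Both honest strategies are replaced by strategies with unitary moves that keep
their environments in the private register (`exists_pure_alice`, `exists_pure_bob`). The other party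
notices no difference, so each purified strategy is a dishonest strategy that never causes an abort,
and weak security applies to it. Two purified parties end in a vector `ψ`. Let `ψ_{c,d}` be its
component on which `z₀ ⊕ z₁ = c` and Bob's index string is `d`. By weak security the state of Bob
and the message on label `c` is the same for all `c`, and that of Alice and the message on label `d`
is the same for all `d`. Uhlmann's theorem (`exists_unitary_mul_eq`) then gives local unitaries with
`ψ_{c,d} = (V_c ⊗ U_d) ψ_{0,0}`.

Conjugating the output observables by `V_c` and `U_d` yields an entangled strategy for `n` parallel
CHSH games on the fixed vector `ψ_{0,0}`: bitwise, `w = z_b` means `z₀ ⊕ w = c ∧ d`. The probability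
of winning all games is the average, over the subsets `S` of games, of the bias of the XOR of the
games in `S`. A norm estimate for Hadamard matrices (`sum_hadamard_inner_le`) bounds this bias by
`(√2/2)^|S|`, and `2⁻ⁿ ∑_S (√2/2)^|S| = ((1 + √2/2)/2)ⁿ = (cos²(π/8))ⁿ`.

Attainment. Alice sends the `2 → 1` quantum random access code of two random bits, and Bob measures
in one of two random bases. The two code states with a given XOR form an orthonormal basis, so their
mixture hides the XOR; Bob sends nothing back that depends on his choice.

Parallel copies. The honest run is a tensor power (`jointState_pow`), which gives correctness. For
security, the hidden string is changed one bit at a time: a cheater against `n + 1` copies can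
simulate all honest copies but one, and so becomes a cheater against a single copy
(`jointState_absorbBob`, `jointState_absorbAlice`). -/

namespace QOT

open Matrix
open scoped Kronecker ComplexOrder

set_option linter.unusedSectionVars false

/-! ### Kraus maps and channels acting on a subsystem. -/

section Kraus

variable {X Y Z κ κ' : Type} [Fintype X] [Fintype Y] [Fintype κ] [Fintype κ']

/-- The completely positive map with Kraus operators `K`. -/
def krausMap (K : κ → Matrix X X ℂ) (ρ : Matrix X X ℂ) : Matrix X X ℂ :=
  ∑ k, K k * ρ * (K k)ᴴ

theorem krausMap_krausMap (K : κ → Matrix X X ℂ) (L : κ' → Matrix X X ℂ) (ρ : Matrix X X ℂ) :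
    krausMap K (krausMap L ρ) = krausMap (fun p : κ × κ' => K p.1 * L p.2) ρ := by
  simp only [krausMap, Fintype.sum_prod_type, Finset.mul_sum, Finset.sum_mul,
    Matrix.conjTranspose_mul, Matrix.mul_assoc]

theorem krausMap_equiv (e : κ' ≃ κ) (K : κ → Matrix X X ℂ) (ρ : Matrix X X ℂ) :
    krausMap (fun k => K (e k)) ρ = krausMap K ρ :=
  e.sum_comp fun k => K k * ρ * (K k)ᴴ

theorem krausMap_submatrix (e : Y ≃ X) (K : κ → Matrix X X ℂ) (ρ : Matrix X X ℂ) :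
    (krausMap K ρ).submatrix e e =
      krausMap (fun k => (K k).submatrix e e) (ρ.submatrix e e) := by
  ext x y
  simp only [krausMap, Matrix.conjTranspose_submatrix, Matrix.submatrix_mul_equiv,
    Matrix.sum_apply, Matrix.submatrix_apply]

theorem krausMap_posSemidef (K : κ → Matrix X X ℂ) {ρ : Matrix X X ℂ} (h : ρ.PosSemidef) :
    (krausMap K ρ).PosSemidef :=
  Matrix.posSemidef_sum _ fun k _ => h.mul_mul_conjTranspose_same (K k)

variable [DecidableEq X] [DecidableEq Y] [Fintype Z] [DecidableEq Z]

theorem trace_krausMap (K : κ → Matrix X X ℂ) (hK : ∑ k, (K k)ᴴ * K k = 1)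
    (ρ : Matrix X X ℂ) : (krausMap K ρ).trace = ρ.trace := by
  have : ∀ k, (K k * ρ * (K k)ᴴ).trace = ((K k)ᴴ * K k * ρ).trace := fun k => by
    rw [Matrix.trace_mul_comm, Matrix.mul_assoc]
  rw [krausMap, Matrix.trace_sum]
  simp only [this]
  rw [← Matrix.trace_sum, ← Finset.sum_mul, hK, Matrix.one_mul]

/-- Two channels, one after the other. -/
def Channel.comp (C D : Channel X) : Channel X where
  κ := C.κ × D.κ
  op p := C.op p.1 * D.op p.2
  trace_preserving := by
    have : ∀ p : C.κ × D.κ, (C.op p.1 * D.op p.2)ᴴ * (C.op p.1 * D.op p.2) =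
        (D.op p.2)ᴴ * ((C.op p.1)ᴴ * C.op p.1) * D.op p.2 := fun p => by
      simp only [Matrix.conjTranspose_mul, Matrix.mul_assoc]
    simp only [this]
    -- The index of the outer channel `C` is summed first, so that its normalization collapses in
    -- the middle of the product.
    rw [Fintype.sum_prod_type_right]
    simp only [← Finset.sum_mul, ← Finset.mul_sum, C.trace_preserving, Matrix.mul_one,
      D.trace_preserving]

/-- The operator `K` on a subsystem, identified by `e`, tensored with the identity. -/
def liftOp (e : Y ≃ X × Z) (K : Matrix X X ℂ) : Matrix Y Y ℂ :=
  (K ⊗ₖ (1 : Matrix Z Z ℂ)).submatrix e e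

theorem liftOp_apply (e : Y ≃ X × Z) (K : Matrix X X ℂ) (x y : Y) :
    liftOp e K x y = if (e x).2 = (e y).2 then K (e x).1 (e y).1 else 0 := by
  simp [liftOp, Matrix.one_apply]

theorem liftOp_mul (e : Y ≃ X × Z) (K L : Matrix X X ℂ) :
    liftOp e (K * L) = liftOp e K * liftOp e L := by
  rw [liftOp, liftOp, liftOp, Matrix.submatrix_mul_equiv, ← Matrix.mul_kronecker_mul,
    Matrix.one_mul]

theorem liftOp_conjTranspose (e : Y ≃ X × Z) (K : Matrix X X ℂ) :
    liftOp e Kᴴ = (liftOp e K)ᴴ := by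
  rw [liftOp, liftOp, Matrix.conjTranspose_submatrix, Matrix.conjTranspose_kronecker,
    Matrix.conjTranspose_one]

theorem liftOp_one (e : Y ≃ X × Z) : liftOp e (1 : Matrix X X ℂ) = 1 := by
  rw [liftOp, Matrix.one_kronecker_one, Matrix.submatrix_one_equiv]

theorem sum_liftOp_conjTranspose_mul (e : Y ≃ X × Z) (K : κ → Matrix X X ℂ)
    (hK : ∑ k, (K k)ᴴ * K k = 1) : ∑ k, (liftOp e (K k))ᴴ * liftOp e (K k) = 1 := by
  have h : ∑ k, (liftOp e (K k))ᴴ * liftOp e (K k) = liftOp e (∑ k, (K k)ᴴ * K k) := by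
    simp only [← liftOp_conjTranspose, ← liftOp_mul]
    ext x y
    simp only [Matrix.sum_apply, liftOp_apply]
    split_ifs <;> simp
  rw [h, hK, liftOp_one]

/-- The block of a matrix that belongs to a pair of basis states of the second factor. -/
def block (e : Y ≃ X × Z) (z z' : Z) (ρ : Matrix Y Y ℂ) : Matrix X X ℂ :=
  Matrix.of fun u v => ρ (e.symm (u, z)) (e.symm (v, z'))

/-- `K ⊗ 1` leaves the index of the second factor alone, so the blocks evolve independently. All
statements on reduced states, and the entrywise formulas for the moves of the parties, come from
this. -/
theorem block_krausMap_liftOp (e : Y ≃ X × Z) (z z' : Z) (K : κ → Matrix X X ℂ)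
    (ρ : Matrix Y Y ℂ) :
    block e z z' (krausMap (fun k => liftOp e (K k)) ρ) = krausMap K (block e z z' ρ) := by
  ext x y
  simp only [block, krausMap, Matrix.sum_apply, Matrix.of_apply, ← liftOp_conjTranspose]
  refine Finset.sum_congr rfl fun k _ => ?_
  simp only [Matrix.mul_apply, Matrix.of_apply]
  rw [← e.symm.sum_comp, Fintype.sum_prod_type]
  refine Finset.sum_congr rfl fun v _ => ?_
  rw [Finset.sum_eq_single z']
  · congr 1
    · rw [← e.symm.sum_comp, Fintype.sum_prod_type]
      refine Finset.sum_congr rfl fun u _ => ?_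
      rw [Finset.sum_eq_single z]
      · simp [liftOp_apply]
      · intro w _ hw
        simp [liftOp_apply, hw.symm]
      · simp
    · simp [liftOp_apply]
  · intro w _ hw
    rw [liftOp_apply, if_neg (by simpa using hw), mul_zero]
  · simp

theorem krausMap_sum {ι : Type} (K : κ → Matrix X X ℂ) (s : Finset ι) (ρ : ι → Matrix X X ℂ) :
    krausMap K (∑ i ∈ s, ρ i) = ∑ i ∈ s, krausMap K (ρ i) := by
  simp only [krausMap, Finset.mul_sum, Finset.sum_mul]
  exact Finset.sum_comm

/-- A channel on a subsystem, identified by `e`. -/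
def Channel.lift (e : Y ≃ X × Z) (C : Channel X) : Channel Y where
  κ := C.κ
  op k := liftOp e (C.op k)
  trace_preserving := sum_liftOp_conjTranspose_mul e C.op C.trace_preserving

end Kraus

/-! ### The moves of the two parties as Kraus maps on subsystems. -/

section Run

variable {A M B : Type} [Fintype A] [DecidableEq A] [Fintype M] [DecidableEq M]
  [Fintype B] [DecidableEq B]

theorem aliceStep_eq (C : Channel (A × M)) (ρ : Matrix (A × M × B) (A × M × B) ℂ) :
    aliceStep C ρ = krausMap (fun k => onAlice (C.op k)) ρ := rfl

theorem bobStep_eq (C : Channel (B × M)) (ρ : Matrix (A × M × B) (A × M × B) ℂ) :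
    bobStep C ρ = krausMap (fun k => onBob (C.op k)) ρ := rfl

/-- Bob's registers put in front. -/
def bobFirst : A × M × B ≃ (B × M) × A where
  toFun x := ((x.2.2, x.2.1), x.1)
  invFun x := (x.2, x.1.2, x.1.1)
  left_inv _ := rfl
  right_inv _ := rfl

theorem onAlice_eq_liftOp (K : Matrix (A × M) (A × M) ℂ) :
    (onAlice K : Matrix (A × M × B) (A × M × B) ℂ) = liftOp (Equiv.prodAssoc A M B).symm K := by
  ext x y
  rw [liftOp_apply]
  rfl

theorem onBob_eq_liftOp (K : Matrix (B × M) (B × M) ℂ) :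
    (onBob K : Matrix (A × M × B) (A × M × B) ℂ) = liftOp bobFirst K := by
  ext x y
  rw [liftOp_apply]
  rfl

theorem onAlice_mul (K L : Matrix (A × M) (A × M) ℂ) :
    (onAlice (K * L) : Matrix (A × M × B) (A × M × B) ℂ) = onAlice K * onAlice L := by
  simp only [onAlice_eq_liftOp, liftOp_mul]

theorem onBob_mul (K L : Matrix (B × M) (B × M) ℂ) :
    (onBob (K * L) : Matrix (A × M × B) (A × M × B) ℂ) = onBob K * onBob L := by
  simp only [onBob_eq_liftOp, liftOp_mul]

theorem trace_aliceStep (C : Channel (A × M)) (ρ : Matrix (A × M × B) (A × M × B) ℂ) :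
    (aliceStep C ρ).trace = ρ.trace := by
  rw [aliceStep_eq, trace_krausMap]
  simp only [onAlice_eq_liftOp]
  exact sum_liftOp_conjTranspose_mul _ _ C.trace_preserving

theorem trace_bobStep (C : Channel (B × M)) (ρ : Matrix (A × M × B) (A × M × B) ℂ) :
    (bobStep C ρ).trace = ρ.trace := by
  rw [bobStep_eq, trace_krausMap]
  simp only [onBob_eq_liftOp]
  exact sum_liftOp_conjTranspose_mul _ _ C.trace_preserving

theorem aliceStep_comp (C D : Channel (A × M)) (ρ : Matrix (A × M × B) (A × M × B) ℂ) :
    aliceStep (C.comp D) ρ = aliceStep C (aliceStep D ρ) := by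
  rw [aliceStep_eq C, aliceStep_eq D, krausMap_krausMap, aliceStep_eq]
  simp only [← onAlice_mul]
  rfl

theorem bobStep_comp (C D : Channel (B × M)) (ρ : Matrix (A × M × B) (A × M × B) ℂ) :
    bobStep (C.comp D) ρ = bobStep C (bobStep D ρ) := by
  rw [bobStep_eq C, bobStep_eq D, krausMap_krausMap, bobStep_eq]
  simp only [← onBob_mul]
  rfl

/-- Alice's indices are parameters during Bob's move; this reduces computations with a concrete
channel to Bob's own space. -/
theorem bobStep_apply (C : Channel (B × M)) (ρ : Matrix (A × M × B) (A × M × B) ℂ)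
    (a a' : A) (m m' : M) (b b' : B) :
    bobStep C ρ (a, m, b) (a', m', b') =
      krausMap C.op (Matrix.of fun u v => ρ (a, u.2, u.1) (a', v.2, v.1)) (b, m) (b', m') := by
  rw [bobStep_eq]
  simp only [onBob_eq_liftOp]
  exact congrFun (congrFun (block_krausMap_liftOp bobFirst a a' C.op ρ) (b, m)) (b', m')

theorem aliceStep_apply (C : Channel (A × M)) (ρ : Matrix (A × M × B) (A × M × B) ℂ)
    (a a' : A) (m m' : M) (b b' : B) :
    aliceStep C ρ (a, m, b) (a', m', b') =
      krausMap C.op (Matrix.of fun u v => ρ (u.1, u.2, b) (v.1, v.2, b')) (a, m) (a', m') := by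
  rw [aliceStep_eq]
  simp only [onAlice_eq_liftOp]
  exact congrFun (congrFun (block_krausMap_liftOp (Equiv.prodAssoc A M B).symm b b' C.op ρ)
    (a, m)) (a', m')

end Run

/-! ### Joint states are density matrices. -/

section Joint

variable {M : Type} [Fintype M] [DecidableEq M] (m₀ : M) (α β : Strategy M)

theorem trace_jointState (t : ℕ) : (jointState m₀ α β t).trace = 1 := by
  induction t with
  | zero => simp [jointState]
  | succ t ih => simp only [jointState, trace_bobStep, trace_aliceStep, ih]

theorem jointState_posSemidef (t : ℕ) : (jointState m₀ α β t).PosSemidef := by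
  induction t with
  | zero =>
    simp only [jointState]
    rw [← Matrix.diagonal_single]
    exact Matrix.posSemidef_diagonal_iff.2 fun i => by
      rw [Pi.single_apply]; split_ifs <;> simp
  | succ t ih =>
    simp only [jointState]
    rw [bobStep_eq, aliceStep_eq]
    exact krausMap_posSemidef _ (krausMap_posSemidef _ ih)

end Joint

/-! ### Regrouping the registers of several copies around one of them. -/

section Split

variable {A M B κ : Type} [Fintype A] [DecidableEq A] [Fintype M] [DecidableEq M]
  [Fintype B] [DecidableEq B] {n : ℕ}

/-- The registers of `n + 1` copies of Bob, split into those of the `i`-th copy and the rest,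
where the latter are given to Alice. -/
def splitBob (i : Fin (n + 1)) :
    (A × (Fin n → M) × (Fin n → B)) × M × B ≃ A × (Fin (n + 1) → M) × (Fin (n + 1) → B) where
  toFun x := (x.1.1, i.insertNth x.2.1 x.1.2.1, i.insertNth x.2.2 x.1.2.2)
  invFun y := ((y.1, i.removeNth y.2.1, i.removeNth y.2.2), y.2.1 i, y.2.2 i)
  left_inv x := by simp
  right_inv y := by simp

/-- The registers of `n + 1` copies of Alice, split into those of the `i`-th copy and the rest,
where the latter are given to Bob. -/
def splitAlice (i : Fin (n + 1)) :
    A × M × (B × (Fin n → M) × (Fin n → A)) ≃ (Fin (n + 1) → A) × (Fin (n + 1) → M) × B where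
  toFun x := (i.insertNth x.1 x.2.2.2.2, i.insertNth x.2.1 x.2.2.2.1, x.2.2.1)
  invFun y := (y.1 i, y.2.1 i, (y.2.2, i.removeNth y.2.1, i.removeNth y.1))
  left_inv x := by simp
  right_inv y := by simp

/-- The systems on which a dishonest party acts, inside those that it has after absorbing the
honest copies except the `i`-th. -/
def ownSystems (i : Fin (n + 1)) :
    (A × (Fin n → M) × (Fin n → B)) × M ≃ (A × (Fin (n + 1) → M)) × (Fin n → B) where
  toFun x := ((x.1.1, i.insertNth x.2 x.1.2.1), x.1.2.2)
  invFun y := ((y.1.1, i.removeNth y.1.2, y.2), y.1.2 i)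
  left_inv x := by simp
  right_inv y := by simp

/-- The systems on which the absorbed honest copies act. -/
def absorbedSystems :
    (A × (Fin n → M) × (Fin n → B)) × M ≃ ((Fin n → B) × (Fin n → M)) × (A × M) where
  toFun x := ((x.1.2.2, x.1.2.1), (x.1.1, x.2))
  invFun y := ((y.2.1, y.1.2, y.1.1), y.2.2)
  left_inv _ := rfl
  right_inv _ := rfl

theorem insertNth_eq_iff {S : Type} (i : Fin (n + 1)) (a a' : S) (f f' : Fin n → S) :
    (i.insertNth a f : Fin (n + 1) → S) = i.insertNth a' f' ↔ a = a' ∧ f = f' :=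
  Fin.insertNth_inj

theorem onAlice_splitBob (i : Fin (n + 1))
    (K : Matrix (A × (Fin (n + 1) → M)) (A × (Fin (n + 1) → M)) ℂ) :
    (onAlice K : Matrix (A × _ × (Fin (n + 1) → B)) _ ℂ).submatrix (splitBob i) (splitBob i) =
      onAlice (liftOp (ownSystems i) K) := by
  ext x y
  simp only [onAlice, Matrix.submatrix_apply, Matrix.of_apply, liftOp_apply, splitBob, ownSystems,
    Equiv.coe_fn_mk, insertNth_eq_iff]
  split_ifs <;> simp_all

theorem onBob_splitAlice (i : Fin (n + 1))
    (K : Matrix (B × (Fin (n + 1) → M)) (B × (Fin (n + 1) → M)) ℂ) :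
    (onBob K : Matrix ((Fin (n + 1) → A) × _ × B) _ ℂ).submatrix (splitAlice i) (splitAlice i) =
      onBob (liftOp (ownSystems i) K) := by
  ext x y
  simp only [onBob, Matrix.submatrix_apply, Matrix.of_apply, liftOp_apply, splitAlice, ownSystems,
    Equiv.coe_fn_mk, insertNth_eq_iff]
  split_ifs <;> simp_all

theorem tensorOp_insertNth (K : κ → Matrix (A × M) (A × M) ℂ) (i : Fin (n + 1)) (k : κ)
    (l : Fin n → κ) (a a' : A) (f f' : Fin n → A) (m m' : M) (g g' : Fin n → M) :
    tensorOp K (i.insertNth k l) (i.insertNth a f, i.insertNth m g)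
      (i.insertNth a' f', i.insertNth m' g') =
      K k (a, m) (a', m') * tensorOp K l (f, g) (f', g') := by
  simp [tensorOp, Fin.prod_univ_succAbove _ i]

/-- The tensor product factors into the part of the `i`-th copy, which stays with honest Bob, and
the part of the other copies, which lies entirely within the systems given to Alice. -/
theorem onBob_tensorOp_splitBob (K : κ → Matrix (B × M) (B × M) ℂ) (i : Fin (n + 1)) (k : κ)
    (l : Fin n → κ) :
    (onBob (tensorOp K (i.insertNth k l)) :
        Matrix (A × _ × (Fin (n + 1) → B)) _ ℂ).submatrix (splitBob i) (splitBob i) =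
      onBob (K k) * onAlice (liftOp absorbedSystems (tensorOp K l)) := by
  ext x y
  -- The intermediate index is forced: the left factor fixes Alice's register, the right one fixes
  -- Bob's register and the message of the `i`-th copy.
  rw [Matrix.mul_apply, Finset.sum_eq_single (x.1, y.2.1, y.2.2)]
  · simp only [onBob, onAlice, Matrix.submatrix_apply, Matrix.of_apply, liftOp_apply, splitBob,
      absorbedSystems, Equiv.coe_fn_mk, tensorOp_insertNth]
    split_ifs <;> simp_all
  · intro z _ hz
    simp only [onBob, onAlice, Matrix.of_apply, liftOp_apply, absorbedSystems, Equiv.coe_fn_mk]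
    by_contra h
    apply hz
    grind
  · simp

theorem onAlice_tensorOp_splitAlice (K : κ → Matrix (A × M) (A × M) ℂ) (i : Fin (n + 1)) (k : κ)
    (l : Fin n → κ) :
    (onAlice (tensorOp K (i.insertNth k l)) :
        Matrix ((Fin (n + 1) → A) × _ × B) _ ℂ).submatrix (splitAlice i) (splitAlice i) =
      onBob (liftOp absorbedSystems (tensorOp K l)) * onAlice (K k) := by
  ext x y
  rw [Matrix.mul_apply, Finset.sum_eq_single (x.1, x.2.1, y.2.2)]
  · simp only [onBob, onAlice, Matrix.submatrix_apply, Matrix.of_apply, liftOp_apply, splitAlice,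
      absorbedSystems, Equiv.coe_fn_mk, tensorOp_insertNth]
    split_ifs <;> simp_all [mul_comm]
  · intro z _ hz
    simp only [onBob, onAlice, Matrix.of_apply, liftOp_apply, absorbedSystems, Equiv.coe_fn_mk]
    by_contra h
    apply hz
    grind
  · simp

end Split

/-! ### A cheater against many copies as a cheater against one copy. -/

section Absorb

variable {M : Type} [Fintype M] [DecidableEq M] {n : ℕ}

/-- A dishonest first mover `α` against `n + 1` copies of `β` plays all copies of `β` except the
`i`-th herself. -/
def absorbBob (m₀ : M) (β : Strategy M) (i : Fin (n + 1)) (α : Strategy (Fin (n + 1) → M)) :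
    Strategy M where
  S := α.S × (Fin n → M) × (Fin n → β.S)
  init := (α.init, fun _ => m₀, fun _ => β.init)
  move t := (((β.move t).pow n).lift absorbedSystems).comp ((α.move t).lift (ownSystems i))

/-- A dishonest second mover `β` against `n + 1` copies of `α` plays all copies of `α` except the
`i`-th himself. -/
def absorbAlice (m₀ : M) (α : Strategy M) (i : Fin (n + 1)) (β : Strategy (Fin (n + 1) → M)) :
    Strategy M where
  S := β.S × (Fin n → M) × (Fin n → α.S)
  init := (β.init, fun _ => m₀, fun _ => α.init)
  move t := ((β.move t).lift (ownSystems i)).comp (((α.move t).pow n).lift absorbedSystems)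

theorem insertNth_const {S : Type} (i : Fin (n + 1)) (a : S) :
    (i.insertNth a fun _ => a : Fin (n + 1) → S) = fun _ => a := by
  rw [← Fin.insertNth_self_removeNth i (fun _ : Fin (n + 1) => a)]
  rfl

theorem single_submatrix_equiv {X Y : Type} [DecidableEq X] [DecidableEq Y] (e : Y ≃ X) (y : Y) :
    (Matrix.single (e y) (e y) (1 : ℂ)).submatrix e e = Matrix.single y y 1 := by
  ext u v
  simp [Matrix.single_apply]

/-- In each round the cheater moves before all the Bobs, and the moves of different Bobs act on
different registers. Hence the absorbed Bobs may move right after the cheater, within her turn, and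
the two runs differ only in the grouping of the registers. -/
theorem jointState_absorbBob (m₀ : M) (β : Strategy M) (i : Fin (n + 1))
    (α : Strategy (Fin (n + 1) → M)) (t : ℕ) :
    jointState m₀ (absorbBob m₀ β i α) β t =
      (jointState (fun _ => m₀) α (β.pow (n + 1)) t).submatrix (splitBob i) (splitBob i) := by
  induction t with
  | zero =>
    have h : (α.init, (fun _ => m₀ : Fin (n + 1) → M), (β.pow (n + 1)).init) =
        splitBob i ((absorbBob m₀ β i α).init, m₀, β.init) := by
      simp only [splitBob, absorbBob, Equiv.coe_fn_mk, insertNth_const]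
      rfl
    simp only [jointState]
    rw [h]
    exact (single_submatrix_equiv (splitBob i) ((absorbBob m₀ β i α).init, m₀, β.init)).symm
  | succ t ih =>
    simp only [jointState]
    have hA := aliceStep_comp (B := β.S) (((β.move t).pow n).lift absorbedSystems)
      ((α.move t).lift (ownSystems i)) (jointState m₀ (absorbBob m₀ β i α) β t)
    erw [hA]
    rw [ih, aliceStep_eq ((α.move t).lift (ownSystems i))]
    have h1 : ∀ ρ : Matrix (α.S × (Fin (n + 1) → M) × (Fin (n + 1) → β.S)) _ ℂ,
        krausMap (fun k => onAlice (((α.move t).lift (ownSystems i)).op k))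
          (ρ.submatrix (splitBob i) (splitBob i)) =
        (aliceStep (α.move t) ρ).submatrix (splitBob i) (splitBob i) := fun ρ => by
      rw [aliceStep_eq, krausMap_submatrix]
      simp only [onAlice_splitBob]
      rfl
    have h2 : ∀ ρ : Matrix (α.S × (Fin (n + 1) → M) × (Fin (n + 1) → β.S)) _ ℂ,
        bobStep (β.move t) (aliceStep (((β.move t).pow n).lift absorbedSystems)
          (ρ.submatrix (splitBob i) (splitBob i))) =
        (bobStep ((β.move t).pow (n + 1)) ρ).submatrix (splitBob i) (splitBob i) := fun ρ => by
      rw [bobStep_eq, aliceStep_eq, krausMap_krausMap, bobStep_eq, krausMap_submatrix]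
      -- A tuple of Kraus indices is a Kraus index for the `i`-th copy together with a tuple for the
      -- other copies.
      erw [← krausMap_equiv (Fin.insertNthEquiv (fun _ => (β.move t).κ) i)]
      refine congrArg (fun K => krausMap K _) (funext fun p => ?_)
      exact (onBob_tensorOp_splitBob (β.move t).op i p.1 p.2).symm
    erw [h1, h2]
    rfl

/-- Mirror image of `jointState_absorbBob`: here the absorbed Alices move at the start of the
cheater's turn, directly after the honest Alice and before his own move. -/
theorem jointState_absorbAlice (m₀ : M) (α : Strategy M) (i : Fin (n + 1))
    (β : Strategy (Fin (n + 1) → M)) (t : ℕ) :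
    jointState m₀ α (absorbAlice m₀ α i β) t =
      (jointState (fun _ => m₀) (α.pow (n + 1)) β t).submatrix (splitAlice i) (splitAlice i) := by
  induction t with
  | zero =>
    have h : ((α.pow (n + 1)).init, (fun _ => m₀ : Fin (n + 1) → M), β.init) =
        splitAlice i (α.init, m₀, (absorbAlice m₀ α i β).init) := by
      simp only [splitAlice, absorbAlice, Equiv.coe_fn_mk, insertNth_const]
      rfl
    simp only [jointState]
    rw [h]
    exact (single_submatrix_equiv (Y := α.S × M × (absorbAlice m₀ α i β).S)
      (splitAlice i) (α.init, m₀, (absorbAlice m₀ α i β).init)).symm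
  | succ t ih =>
    simp only [jointState]
    have hB := bobStep_comp (A := α.S) ((β.move t).lift (ownSystems i))
      (((α.move t).pow n).lift absorbedSystems)
      (aliceStep (α.move t) (jointState m₀ α (absorbAlice m₀ α i β) t))
    erw [hB]
    rw [ih]
    have h1 : ∀ ρ : Matrix ((Fin (n + 1) → α.S) × (Fin (n + 1) → M) × β.S) _ ℂ,
        bobStep ((β.move t).lift (ownSystems i)) (ρ.submatrix (splitAlice i) (splitAlice i)) =
        (bobStep (β.move t) ρ).submatrix (splitAlice i) (splitAlice i) := fun ρ => by
      rw [bobStep_eq, bobStep_eq, krausMap_submatrix]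
      simp only [onBob_splitAlice]
      rfl
    have h2 : ∀ ρ : Matrix ((Fin (n + 1) → α.S) × (Fin (n + 1) → M) × β.S) _ ℂ,
        bobStep (((α.move t).pow n).lift absorbedSystems) (aliceStep (α.move t)
          (ρ.submatrix (splitAlice i) (splitAlice i))) =
        (aliceStep ((α.move t).pow (n + 1)) ρ).submatrix (splitAlice i) (splitAlice i) :=
        fun ρ => by
      rw [bobStep_eq, aliceStep_eq, krausMap_krausMap, aliceStep_eq, krausMap_submatrix]
      erw [← krausMap_equiv (Fin.insertNthEquiv (fun _ => (α.move t).κ) i)]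
      -- The absorbed copies are now applied after the `i`-th one, so the pair of Kraus indices
      -- occurs in the opposite order.
      erw [← krausMap_equiv (Equiv.prodComm _ _)]
      refine congrArg (fun K => krausMap K _) (funext fun p => ?_)
      exact (onAlice_tensorOp_splitAlice (α.move t).op i p.1 p.2).symm
    erw [h2, h1]
    rfl

end Absorb

/-! ### Combining the outputs of the copies. -/

section Collect

variable {n : ℕ}

theorem collect_eq_some_iff (o : Fin n → Option (Bits 1 × Bits 1)) (z : Bits n × Bits n) :
    collect o = some z ↔ ∀ i, o i = some (fun _ => z.1 i, fun _ => z.2 i) := by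
  unfold collect
  split_ifs with h
  · have h' : ∀ i, ∃ y, o i = some y := fun i => Option.isSome_iff_exists.1 (h i)
    choose y hy using h'
    obtain rfl : o = fun i => some (y i) := funext hy
    simp only [Option.get_some, Option.some.injEq, Prod.ext_iff, funext_iff]
    constructor
    · rintro ⟨h1, h2⟩ i
      refine ⟨fun j => ?_, fun j => ?_⟩ <;> rw [Subsingleton.elim j 0]
      exacts [h1 i, h2 i]
    · intro h
      exact ⟨fun i => (h i).1 0, fun i => (h i).2 0⟩
  · constructor
    · intro h; cases h
    · intro h2
      exact absurd (fun i => by rw [h2 i]; rfl) h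

theorem collect_eq_none_iff (o : Fin n → Option (Bits 1 × Bits 1)) :
    collect o = none ↔ ∃ i, o i = none := by
  unfold collect
  split_ifs with h
  · simp only [false_iff, not_exists]
    intro i hi
    simpa [hi] using h i
  · simpa using h

theorem bits_one_eq (b : Bits 1) : (fun _ => b 0) = b :=
  funext fun j => by rw [Subsingleton.elim j 0]

/-- Having an index string entails that no copy is aborted, so the event factors over the copies.
This is what allows one coordinate to be isolated in `aliceView_pow`. -/
theorem collect_map_fst_iff (o : Fin n → Option (Bits 1 × Bits 1)) (b : Bits n) :
    (collect o).map Prod.fst = some b ↔ ∀ i, (o i).map Prod.fst = some fun _ => b i := by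
  simp only [Option.map_eq_some_iff, collect_eq_some_iff]
  constructor
  · rintro ⟨z, hz, rfl⟩ i
    exact ⟨_, hz i, rfl⟩
  · intro h
    choose y hy hyb using h
    refine ⟨(b, fun i => (y i).2 0), fun i => ?_, rfl⟩
    rw [hy i, ← hyb i, bits_one_eq]

theorem collect_map_xorBits_iff (o : Fin n → Option (Bits 1 × Bits 1)) (x : Bits n) :
    (collect o).map xorBits = some x ↔ ∀ i, (o i).map xorBits = some fun _ => x i := by
  simp only [Option.map_eq_some_iff, collect_eq_some_iff]
  constructor
  · rintro ⟨z, hz, rfl⟩ i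
    exact ⟨_, hz i, rfl⟩
  · intro h
    choose y hy hyx using h
    refine ⟨(fun i => (y i).1 0, fun i => (y i).2 0), fun i => ?_, funext fun i => ?_⟩
    · rw [hy i, bits_one_eq, bits_one_eq]
    · exact congrFun (hyx i) 0

end Collect

/-- A function of bit strings that is insensitive to changes of single bits is constant. -/
theorem eq_of_forall_succAbove_eq {n : ℕ} {T : Type*} (f : Bits (n + 1) → T)
    (h : ∀ i b b', (∀ j, b (Fin.succAbove i j) = b' (Fin.succAbove i j)) → f b = f b')
    (b b' : Bits (n + 1)) : f b = f b' := by
  -- Hybrid argument: the positions in `s` already carry the bits of `b`, the others those of `b'`,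
  -- and enlarging `s` by one element changes a single position.
  have key : ∀ s : Finset (Fin (n + 1)), f (s.piecewise b b') = f b' := by
    intro s
    induction s using Finset.induction_on with
    | empty => simp
    | insert i s _ ih =>
      rw [← ih, Finset.piecewise_insert]
      exact h i _ _ fun j => by simp
  simpa using key Finset.univ

/-- Summation over tuples of which all entries satisfy a condition, one coordinate taken apart. -/
theorem sum_filter_insertNth {S : Type} [Fintype S] {n : ℕ} (i : Fin (n + 1))
    (p : Fin (n + 1) → S → Prop) [∀ j, DecidablePred (p j)] (F : (Fin (n + 1) → S) → ℂ) :
    ∑ s with ∀ j, p j (s j), F s =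
      ∑ s' : Fin n → S with ∀ j, p (i.succAbove j) (s' j),
        ∑ s with p i s, F (i.insertNth s s') := by
  simp only [Finset.sum_filter]
  rw [← (Fin.insertNthEquiv (fun _ => S) i).sum_comp, Fintype.sum_prod_type_right]
  refine Finset.sum_congr rfl fun s' _ => ?_
  have h : ∀ s, (∀ j, p j ((Fin.insertNthEquiv (fun _ => S) i) (s, s') j)) ↔
      (∀ j, p (i.succAbove j) (s' j)) ∧ p i s := fun s => by
    simp [Fin.forall_iff_succAbove i, and_comm]
  simp only [h, ite_and]
  split_ifs
  · rfl
  · exact Finset.sum_const_zero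

theorem splitBob_removeNth {A M B : Type} {n : ℕ} (i : Fin (n + 1)) (a : A)
    (m : Fin (n + 1) → M) (f : Fin n → B) (s : B) :
    splitBob i ((a, i.removeNth m, f), m i, s) = (a, m, i.insertNth s f) := by
  simp [splitBob]

theorem splitAlice_removeNth {A M B : Type} {n : ℕ} (i : Fin (n + 1)) (b : B)
    (m : Fin (n + 1) → M) (f : Fin n → A) (s : A) :
    splitAlice i (s, m i, (b, i.removeNth m, f)) = (i.insertNth s f, m, b) := by
  simp [splitAlice]

/-! ### Security of parallel copies. -/

namespace Protocol

variable {n : ℕ}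

/-- The absorbed cheater holds more than `α` does, namely the private registers of the other Bobs.
Restricting these to the required outputs and tracing them out recovers the view of `α`, while the
`i`-th bit of `b` enters only through the view for a single copy. -/
theorem aliceView_pow (P : Protocol 1) (i : Fin (n + 1)) (α : Strategy (P.pow (n + 1)).M)
    (b : Bits (n + 1)) (u v : α.S × (Fin (n + 1) → P.M)) :
    (P.pow (n + 1)).aliceView α b u v =
      ∑ s' : Fin n → P.bob.S with ∀ j, (P.bobOut (s' j)).map Prod.fst = some fun _ =>
          b (i.succAbove j),
        P.aliceView (absorbBob P.m₀ P.bob i α) (fun _ => b i)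
          ((u.1, i.removeNth u.2, s'), u.2 i) ((v.1, i.removeNth v.2, s'), v.2 i) := by
  have h := jointState_absorbBob P.m₀ P.bob i α P.rounds
  have h1 : (P.pow (n + 1)).aliceView α b u v =
      ∑ s : Fin (n + 1) → P.bob.S with
        ∀ j, (P.bobOut (s j)).map Prod.fst = some fun _ => b j,
        jointState (fun _ => P.m₀) α (P.bob.pow (n + 1)) P.rounds
          (u.1, u.2, s) (v.1, v.2, s) := by
    simp only [aliceView, ← collect_map_fst_iff]
    rfl
  rw [h1, sum_filter_insertNth i fun j s => (P.bobOut s).map Prod.fst = some fun _ => b j]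
  refine Finset.sum_congr rfl fun s' _ => ?_
  simp only [aliceView, Matrix.of_apply, final]
  refine Finset.sum_congr rfl fun s _ => ?_
  have h2 := congrFun (congrFun h ((u.1, i.removeNth u.2, s'), u.2 i, s))
    ((v.1, i.removeNth v.2, s'), v.2 i, s)
  exact (h2.trans (congrArg₂ (jointState (fun _ => P.m₀) α (P.bob.pow (n + 1)) P.rounds)
    (splitBob_removeNth i u.1 u.2 s' s) (splitBob_removeNth i v.1 v.2 s' s))).symm

theorem bobView_pow (P : Protocol 1) (i : Fin (n + 1)) (β : Strategy (P.pow (n + 1)).M)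
    (x : Bits (n + 1)) (u v : β.S × (Fin (n + 1) → P.M)) :
    (P.pow (n + 1)).bobView β x u v =
      ∑ s' : Fin n → P.alice.S with ∀ j, (P.aliceOut (s' j)).map xorBits = some fun _ =>
          x (i.succAbove j),
        P.bobView (absorbAlice P.m₀ P.alice i β) (fun _ => x i)
          ((u.1, i.removeNth u.2, s'), u.2 i) ((v.1, i.removeNth v.2, s'), v.2 i) := by
  have h := jointState_absorbAlice P.m₀ P.alice i β P.rounds
  have h1 : (P.pow (n + 1)).bobView β x u v =
      ∑ s : Fin (n + 1) → P.alice.S with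
        ∀ j, (P.aliceOut (s j)).map xorBits = some fun _ => x j,
        jointState (fun _ => P.m₀) (P.alice.pow (n + 1)) β P.rounds
          (s, u.2, u.1) (s, v.2, v.1) := by
    simp only [bobView, ← collect_map_xorBits_iff]
    rfl
  rw [h1, sum_filter_insertNth i fun j s => (P.aliceOut s).map xorBits = some fun _ => x j]
  refine Finset.sum_congr rfl fun s' _ => ?_
  simp only [bobView, Matrix.of_apply, final]
  refine Finset.sum_congr rfl fun s _ => ?_
  have h2 := congrFun (congrFun h (s, u.2 i, (u.1, i.removeNth u.2, s')))
    (s, v.2 i, (v.1, i.removeNth v.2, s'))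
  exact (h2.trans (congrArg₂ (jointState (fun _ => P.m₀) (P.alice.pow (n + 1)) β P.rounds)
    (splitAlice_removeNth i u.1 u.2 s' s) (splitAlice_removeNth i v.1 v.2 s' s))).symm

theorem IsSecure.pow {P : Protocol 1} (hP : P.IsSecure) (n : ℕ) : (P.pow n).IsSecure := by
  cases n with
  | zero =>
    exact ⟨fun α b b' => by rw [Subsingleton.elim b b'],
      fun β x x' => by rw [Subsingleton.elim x x']⟩
  | succ n =>
    constructor
    · intro α
      -- It suffices to change the `i`-th bit: the summation range in `aliceView_pow` involves only
      -- the other bits, and the summands agree by the security of one copy.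
      refine eq_of_forall_succAbove_eq _ fun i b b' hb => ?_
      ext u v
      erw [aliceView_pow P i, aliceView_pow P i]
      simp only [hb, hP.against_alice _ (fun _ => b i) (fun _ => b' i)]
    · intro β
      refine eq_of_forall_succAbove_eq _ fun i x x' hx => ?_
      ext u v
      erw [bobView_pow P i, bobView_pow P i]
      simp only [hx, hP.against_bob _ (fun _ => x i) (fun _ => x' i)]

end Protocol

/-! ### The honest run of parallel copies is a tensor power. -/

section Tensor

variable {X κ : Type} [Fintype X] [Fintype κ] {n : ℕ}

/-- The tensor product of the operators `K 0, K 1, …`. -/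
def tensorPi (K : Fin n → Matrix X X ℂ) : Matrix (Fin n → X) (Fin n → X) ℂ :=
  Matrix.of fun x y => ∏ i, K i (x i) (y i)

theorem tensorPi_mul (K L : Fin n → Matrix X X ℂ) :
    tensorPi K * tensorPi L = tensorPi fun i => K i * L i := by
  ext x y
  simp only [Matrix.mul_apply, tensorPi, Matrix.of_apply, Finset.prod_univ_sum,
    Fintype.piFinset_univ, ← Finset.prod_mul_distrib]

theorem tensorPi_conjTranspose (K : Fin n → Matrix X X ℂ) :
    (tensorPi K)ᴴ = tensorPi fun i => (K i)ᴴ := by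
  ext x y
  simp [tensorPi, Matrix.conjTranspose_apply]

theorem krausMap_tensorPi (K : κ → Matrix X X ℂ) (ρ : Matrix X X ℂ) :
    krausMap (fun k : Fin n → κ => tensorPi fun i => K (k i)) (tensorPi fun _ => ρ) =
      tensorPi fun _ => krausMap K ρ := by
  ext x y
  simp only [krausMap, tensorPi_conjTranspose, tensorPi_mul]
  simp only [Matrix.sum_apply, tensorPi, Matrix.of_apply, Finset.prod_univ_sum,
    Fintype.piFinset_univ]

/-- Tuples of triples as triples of tuples. -/
def unzip {A M B : Type} : (Fin n → A × M × B) ≃ (Fin n → A) × (Fin n → M) × (Fin n → B) where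
  toFun x := (fun i => (x i).1, fun i => (x i).2.1, fun i => (x i).2.2)
  invFun y i := (y.1 i, y.2.1 i, y.2.2 i)
  left_inv _ := rfl
  right_inv _ := rfl

variable {A M B : Type} [Fintype A] [DecidableEq A] [Fintype M] [DecidableEq M]
  [Fintype B] [DecidableEq B]

theorem onAlice_unzip (K : κ → Matrix (A × M) (A × M) ℂ) (k : Fin n → κ) :
    (onAlice (tensorOp K k) : Matrix (_ × _ × (Fin n → B)) _ ℂ).submatrix unzip unzip =
      tensorPi fun i => onAlice (K (k i)) := by
  ext x y
  simp only [Matrix.submatrix_apply, onAlice, tensorPi, tensorOp, Matrix.of_apply, unzip,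
    Equiv.coe_fn_mk, Finset.prod_ite_zero, Finset.mem_univ, true_imp_iff, funext_iff]

theorem onBob_unzip (K : κ → Matrix (B × M) (B × M) ℂ) (k : Fin n → κ) :
    (onBob (tensorOp K k) : Matrix ((Fin n → A) × _ × _) _ ℂ).submatrix unzip unzip =
      tensorPi fun i => onBob (K (k i)) := by
  ext x y
  simp only [Matrix.submatrix_apply, onBob, tensorPi, tensorOp, Matrix.of_apply, unzip,
    Equiv.coe_fn_mk, Finset.prod_ite_zero, Finset.mem_univ, true_imp_iff, funext_iff]

theorem single_unzip (a : A) (m : M) (b : B) :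
    (Matrix.single (fun _ => a, fun _ => m, fun _ => b) (fun _ => a, fun _ => m, fun _ => b)
      1).submatrix unzip unzip =
      tensorPi fun _ : Fin n => Matrix.single (a, m, b) (a, m, b) (1 : ℂ) := by
  ext x y
  simp only [Matrix.submatrix_apply, tensorPi, Matrix.of_apply, Matrix.single_apply,
    Finset.prod_ite_zero, Finset.mem_univ, true_imp_iff, Finset.prod_const_one, unzip,
    Equiv.coe_fn_mk, Prod.ext_iff, funext_iff, forall_and]

theorem aliceStep_unzip (C : Channel (A × M)) {ρ : Matrix (A × M × B) (A × M × B) ℂ}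
    {σ : Matrix ((Fin n → A) × (Fin n → M) × (Fin n → B)) _ ℂ}
    (h : σ.submatrix unzip unzip = tensorPi fun _ => ρ) :
    (aliceStep (C.pow n) σ).submatrix unzip unzip = tensorPi fun _ => aliceStep C ρ := by
  rw [aliceStep_eq, krausMap_submatrix, h, aliceStep_eq, ← krausMap_tensorPi]
  exact congrArg (fun K => krausMap K _) (funext fun k => onAlice_unzip _ k)

theorem bobStep_unzip (C : Channel (B × M)) {ρ : Matrix (A × M × B) (A × M × B) ℂ}
    {σ : Matrix ((Fin n → A) × (Fin n → M) × (Fin n → B)) _ ℂ}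
    (h : σ.submatrix unzip unzip = tensorPi fun _ => ρ) :
    (bobStep (C.pow n) σ).submatrix unzip unzip = tensorPi fun _ => bobStep C ρ := by
  rw [bobStep_eq, krausMap_submatrix, h, bobStep_eq, ← krausMap_tensorPi]
  exact congrArg (fun K => krausMap K _) (funext fun k => onBob_unzip _ k)

/-- The initial state is a product, and the Kraus operators of the copies are indexed by all tuples,
so every move preserves the tensor-power form. -/
theorem jointState_pow (m₀ : M) (α β : Strategy M) (t : ℕ) :
    (jointState (fun _ => m₀) (α.pow n) (β.pow n) t).submatrix unzip unzip =
      tensorPi fun _ => jointState m₀ α β t := by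
  induction t with
  | zero => exact single_unzip _ _ _
  | succ t ih => exact bobStep_unzip _ (aliceStep_unzip _ ih)

end Tensor

/-! ### Measurement probabilities of product states. -/

section Prob

variable {X Y : Type} [Fintype X] [Fintype Y] {n : ℕ}

theorem prob_submatrix (e : Y ≃ X) (ρ : Matrix X X ℂ) (E : Set X) :
    prob (ρ.submatrix e e) (e ⁻¹' E) = prob ρ E := by
  rw [prob, prob, ← e.sum_comp]
  rfl

/-- Positivity makes the diagonal real, so that taking real parts commutes with the product. -/
theorem prob_tensorPi {ρ : Matrix X X ℂ} (hρ : ρ.PosSemidef) (E : Fin n → Set X) :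
    prob (tensorPi fun _ => ρ) {x | ∀ i, x i ∈ E i} = ∏ i, prob ρ (E i) := by
  simp only [prob]
  rw [Finset.prod_univ_sum, Fintype.piFinset_univ]
  refine Finset.sum_congr rfl fun x _ => ?_
  have h : ∀ i, ρ (x i) (x i) = ((ρ (x i) (x i)).re : ℂ) := fun i =>
    Complex.ext rfl (Complex.nonneg_iff.1 (hρ.diag_nonneg (i := x i))).2.symm
  by_cases hx : ∀ i, x i ∈ E i
  · rw [Set.indicator_of_mem (by exact hx)]
    simp only [tensorPi, Matrix.of_apply, Set.indicator_of_mem (hx _)]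
    rw [Finset.prod_congr rfl fun i _ => h i, ← Complex.ofReal_prod, Complex.ofReal_re]
  · rw [Set.indicator_of_notMem (by exact hx)]
    push Not at hx
    obtain ⟨i, hi⟩ := hx
    exact (Finset.prod_eq_zero (Finset.mem_univ i) (Set.indicator_of_notMem hi _)).symm

theorem prob_eq_zero_iff {ρ : Matrix X X ℂ} (hρ : ρ.PosSemidef) (E : Set X) :
    prob ρ E = 0 ↔ ∀ x ∈ E, ρ x x = 0 := by
  have h : ∀ x, 0 ≤ (ρ x x).re ∧ 0 = (ρ x x).im := fun x => Complex.nonneg_iff.1 hρ.diag_nonneg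
  rw [prob, Finset.sum_eq_zero_iff_of_nonneg fun x _ => Set.indicator_nonneg (fun x _ => (h x).1) x]
  refine forall_congr' fun x => ?_
  by_cases hx : x ∈ E
  · simp only [Finset.mem_univ, true_imp_iff, Set.indicator_of_mem hx, hx]
    exact ⟨fun h0 => Complex.ext h0 (h x).2.symm, fun h0 => by rw [h0]; rfl⟩
  · simp [hx]

end Prob

/-! ### Correctness of parallel copies. -/

namespace Protocol

variable {n : ℕ}

theorem prob_final_pow (P : Protocol 1) (E : Fin n → Set (P.alice.S × P.M × P.bob.S)) :
    prob ((P.pow n).final (P.pow n).alice (P.pow n).bob) {x | ∀ i, unzip.symm x i ∈ E i} =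
      ∏ i, prob (P.final P.alice P.bob) (E i) := by
  have h := prob_tensorPi (jointState_posSemidef P.m₀ P.alice P.bob P.rounds) E
  rw [← jointState_pow (n := n)] at h
  exact (prob_submatrix unzip (jointState (fun _ => P.m₀) (P.alice.pow n) (P.bob.pow n) P.rounds)
    {x | ∀ i, unzip.symm x i ∈ E i}).symm.trans h

theorem prob_final_pow_exists (P : Protocol 1) (E : Set (P.alice.S × P.M × P.bob.S))
    (hE : prob (P.final P.alice P.bob) E = 0) :
    prob ((P.pow n).final (P.pow n).alice (P.pow n).bob) {x | ∃ i, unzip.symm x i ∈ E} = 0 := by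
  refine (prob_eq_zero_iff (jointState_posSemidef _ _ _ _) _).2 ?_
  rintro x ⟨i, hi⟩
  have h := jointState_pow (n := n) P.m₀ P.alice P.bob P.rounds
  refine (congrFun (congrFun h (unzip.symm x)) (unzip.symm x)).trans ?_
  exact Finset.prod_eq_zero (Finset.mem_univ i)
    ((prob_eq_zero_iff (jointState_posSemidef _ _ _ _) _).1 hE _ hi)

theorem IsOT.pow {P : Protocol 1} {p : ℝ} (hP : P.IsOT p) (n : ℕ) : (P.pow n).IsOT (p ^ n) where
  alice_no_abort := by
    rw [← prob_final_pow_exists P _ hP.alice_no_abort]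
    congr 1
    ext x
    exact collect_eq_none_iff _
  bob_no_abort := by
    rw [← prob_final_pow_exists P _ hP.bob_no_abort]
    congr 1
    ext x
    exact collect_eq_none_iff _
  alice_uniform z := by
    have h := prob_final_pow P fun i => {x | P.aliceOut x.1 = some (fun _ => z.1 i, fun _ => z.2 i)}
    simp only [hP.alice_uniform, Finset.prod_const, Finset.card_univ, Fintype.card_fin] at h
    rw [mul_one, ← pow_mul] at h
    rw [← h]
    congr 1
    ext x
    exact collect_eq_some_iff _ z
  bob_uniform b := by
    have h := prob_final_pow P fun i => {x | ∃ w, P.bobOut x.2.2 = some (fun _ => b i, w)}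
    simp only [hP.bob_uniform, Finset.prod_const, Finset.card_univ, Fintype.card_fin, pow_one] at h
    rw [← h]
    congr 1
    ext x
    constructor
    · rintro ⟨w, hw⟩ i
      exact ⟨_, (collect_eq_some_iff _ _).1 hw i⟩
    · intro hx
      choose w hw using hx
      refine ⟨fun i => w i 0, (collect_eq_some_iff _ _).2 fun i => (hw i).trans ?_⟩
      rw [bits_one_eq]
  correct := by
    have h := prob_final_pow (n := n) P fun _ =>
      {x | ∃ z b, P.aliceOut x.1 = some z ∧ P.bobOut x.2.2 = some (b, select z b)}
    simp only [hP.correct, Finset.prod_const, Finset.card_univ, Fintype.card_fin] at h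
    rw [← h]
    congr 1
    ext x
    constructor
    · rintro ⟨z, b, hz, hb⟩ i
      exact ⟨_, _, (collect_eq_some_iff _ _).1 hz i, (collect_eq_some_iff _ _).1 hb i⟩
    · intro hx
      choose z b hz hb using hx
      refine ⟨(fun i => (z i).1 0, fun i => (z i).2 0), fun i => b i 0,
        (collect_eq_some_iff _ _).2 fun i => (hz i).trans ?_,
        (collect_eq_some_iff _ _).2 fun i => (hb i).trans ?_⟩
      · rw [bits_one_eq, bits_one_eq]
      · rw [bits_one_eq]
        congr 2
        exact (bits_one_eq _).symm

end Protocol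

/-! ### An optimal secure protocol from a quantum random access code. -/

section RandomAccessCode

/-- The qubit that encodes two bits, as a vector in the plane. -/
noncomputable def codeState (z : Bool × Bool) (m : Bool) : ℝ :=
  match z, m with
  | (false, _), false => Real.cos (Real.pi / 8)
  | (true, _), false => Real.sin (Real.pi / 8)
  | (false, false), true => Real.sin (Real.pi / 8)
  | (false, true), true => -Real.sin (Real.pi / 8)
  | (true, false), true => Real.cos (Real.pi / 8)
  | (true, true), true => -Real.cos (Real.pi / 8)

/-- The bases in which the two encoded bits are read: the vector for the value `s.2` of the bit
with index `s.1`. -/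
noncomputable def readState (s : Bool × Bool) (m : Bool) : ℝ :=
  match s, m with
  | (false, false), false => 1
  | (false, false), true => 0
  | (false, true), false => 0
  | (false, true), true => 1
  | (true, _), false => √2 / 2
  | (true, false), true => √2 / 2
  | (true, true), true => -(√2 / 2)

theorem sum_codeState_sq (z : Bool × Bool) : ∑ m, codeState z m * codeState z m = 1 := by
  have := Real.cos_sq_add_sin_sq (Real.pi / 8)
  rcases z with ⟨_ | _, _ | _⟩ <;> simp only [Fintype.sum_bool, codeState] <;> linarith

/-- Complementary pairs of bits have the same XOR and are encoded in orthogonal states. The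
resolution of the identity does not depend on `x`, which is why Bob learns nothing about the XOR. -/
theorem sum_codeState_xor (x m m' : Bool) :
    ∑ z : Bool × Bool with xor z.1 z.2 = x, codeState z m * codeState z m' =
      if m = m' then 1 else 0 := by
  have := Real.cos_sq_add_sin_sq (Real.pi / 8)
  rw [Finset.sum_filter]
  cases x <;> cases m <;> cases m' <;>
    simp [Fintype.sum_prod_type, codeState, -Real.cos_pi_div_eight, -Real.sin_pi_div_eight] <;>
    linarith

/-- Both reading bases are complete. Summing over the outcome therefore erases the choice of basis,
which protects Bob against Alice. -/
theorem sum_readState (b m m' : Bool) :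
    ∑ w, readState (b, w) m * readState (b, w) m' = if m = m' then 1 else 0 := by
  have h : √2 * √2 = 2 := Real.mul_self_sqrt (by norm_num)
  cases b <;> cases m <;> cases m' <;>
    simp [readState] <;> linarith

/-- The bracket with its factor is `cos (π/4 - π/8)`. -/
theorem cos_add_sin_sq : (√2 / 2 * (Real.cos (Real.pi / 8) + Real.sin (Real.pi / 8))) ^ 2 =
    Real.cos (Real.pi / 8) ^ 2 := by
  have h := Real.cos_sub (Real.pi / 4) (Real.pi / 8)
  rw [Real.cos_pi_div_four, Real.sin_pi_div_four, ← mul_add,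
    show Real.pi / 4 - Real.pi / 8 = Real.pi / 8 by ring] at h
  rw [← h]

theorem cos_sub_sin_sq : (√2 / 2 * (Real.cos (Real.pi / 8) - Real.sin (Real.pi / 8))) ^ 2 =
    Real.sin (Real.pi / 8) ^ 2 := by
  have h : √2 ^ 2 = 2 := Real.sq_sqrt (by norm_num)
  have h1 := cos_add_sin_sq
  have h2 := Real.cos_sq_add_sin_sq (Real.pi / 8)
  rw [mul_pow, div_pow, h] at *
  nlinarith

/-- The code states lie at the angles `±π/8` and `±3π/8`, the reading vectors at `0`, `π/2` and
`±π/4` up to sign. As lines, a code state is at angle `π/8` from the vector for the correct value of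
either bit, and at angle `3π/8` from the wrong one. -/
theorem sum_readState_codeState_sq (z s : Bool × Bool) :
    (∑ m, readState s m * codeState z m) ^ 2 =
      if s.2 = (if s.1 then z.2 else z.1) then Real.cos (Real.pi / 8) ^ 2
      else Real.sin (Real.pi / 8) ^ 2 := by
  have h1 := cos_add_sin_sq
  have h2 := cos_sub_sin_sq
  rcases z with ⟨_ | _, _ | _⟩ <;> rcases s with ⟨_ | _, _ | _⟩ <;>
    simp [readState, codeState, -Real.cos_pi_div_eight, -Real.sin_pi_div_eight] <;> linarith

/-- Both parties use measure-and-prepare channels: `g k` is the vector tested and `f k` the state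
prepared. -/
theorem sum_rankOne_conjTranspose_mul {X κ : Type} [Fintype X] [DecidableEq X] [Fintype κ]
    (f g : κ → X → ℂ)
    (h : ∀ u v, ∑ k, (star (f k) ⬝ᵥ f k) * (g k u * star (g k v)) = if u = v then 1 else 0) :
    ∑ k, (vecMulVec (f k) (star (g k)))ᴴ * vecMulVec (f k) (star (g k)) = 1 := by
  ext u v
  rw [Matrix.sum_apply, Matrix.one_apply, ← h]
  refine Finset.sum_congr rfl fun k _ => ?_
  simp only [Matrix.mul_apply, Matrix.conjTranspose_apply, vecMulVec_apply, dotProduct,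
    Finset.sum_mul, Pi.star_apply, star_mul, star_star]
  exact Finset.sum_congr rfl fun _ _ => by ring

theorem krausMap_rankOne_apply {X κ : Type} [Fintype X] [Fintype κ] (f g : κ → X → ℂ)
    (ρ : Matrix X X ℂ) (x x' : X) :
    krausMap (fun k => vecMulVec (f k) (star (g k))) ρ x x' =
      ∑ k, f k x * star (f k x') * ∑ u, ∑ v, star (g k u) * ρ u v * g k v := by
  rw [krausMap, Matrix.sum_apply]
  refine Finset.sum_congr rfl fun k _ => ?_
  simp only [Matrix.mul_apply, Matrix.conjTranspose_apply, vecMulVec_apply,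
    Finset.sum_mul, Finset.mul_sum, Pi.star_apply, star_mul, star_star]
  rw [Finset.sum_comm]
  exact Finset.sum_congr rfl fun _ _ => Finset.sum_congr rfl fun _ _ => by ring

/-- Two bits together with their encoding. -/
noncomputable def encodeKet (k : (Bool × Bool) × ((Bool × Bool) × Bool))
    (u : (Bool × Bool) × Bool) : ℂ :=
  if u.1 = k.1 then ((codeState k.1 u.2 / 2 : ℝ) : ℂ) else 0

/-- The basis state that Alice discards. -/
noncomputable def encodeBra (k : (Bool × Bool) × ((Bool × Bool) × Bool)) :
    (Bool × Bool) × Bool → ℂ :=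
  Pi.single k.2 1

/-- Alice replaces all that she has by the uniform mixture of two bits with their encoding. -/
noncomputable def encodeChannel : Channel ((Bool × Bool) × Bool) where
  κ := (Bool × Bool) × ((Bool × Bool) × Bool)
  op k := vecMulVec (encodeKet k) (star (encodeBra k))
  trace_preserving := by
    refine sum_rankOne_conjTranspose_mul _ _ fun u v => ?_
    have h : ∀ z : Bool × Bool, ∑ m, ((codeState z m / 2 : ℝ) : ℂ) * ((codeState z m / 2 : ℝ) : ℂ) =
        1 / 4 := fun z => by
      have h := sum_codeState_sq z
      rw [Fintype.sum_bool] at h ⊢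
      rw [← Complex.ofReal_mul, ← Complex.ofReal_mul, ← Complex.ofReal_add]
      rw [show codeState z true / 2 * (codeState z true / 2) +
        codeState z false / 2 * (codeState z false / 2) = 1 / 4 by linarith]
      norm_num
    have h' : ∀ k : (Bool × Bool) × ((Bool × Bool) × Bool),
        star (encodeKet k) ⬝ᵥ encodeKet k = 1 / 4 := fun k => by
      rw [← h k.1, dotProduct]
      simp only [Pi.star_apply, encodeKet]
      rw [Fintype.sum_prod_type, Finset.sum_eq_single k.1]
      · simp
      · intro z _ hz
        simp [hz]
      · simp
    simp only [h', ← Finset.mul_sum]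
    rw [Fintype.sum_prod_type]
    simp [encodeBra, Pi.single_apply]

/-- Bob's bits with a fixed message. -/
noncomputable def decodeKet (k : (Bool × Bool) × (Bool × Bool)) : (Bool × Bool) × Bool → ℂ :=
  Pi.single (k.1, false) 1

/-- The vector for Bob's bits in the message space, and the basis state that he discards. -/
noncomputable def decodeBra (k : (Bool × Bool) × (Bool × Bool)) (u : (Bool × Bool) × Bool) : ℂ :=
  if u.1 = k.2 then ((readState k.1 u.2 * (√2 / 2) : ℝ) : ℂ) else 0

/-- Bob replaces all that he has by a uniform bit, the outcome of the measurement of the message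
in the basis given by this bit, and a fixed message. -/
noncomputable def decodeChannel : Channel ((Bool × Bool) × Bool) where
  κ := (Bool × Bool) × (Bool × Bool)
  op k := vecMulVec (decodeKet k) (star (decodeBra k))
  trace_preserving := by
    refine sum_rankOne_conjTranspose_mul _ _ fun u v => ?_
    have h : ∀ k : (Bool × Bool) × (Bool × Bool),
        star (decodeKet k) ⬝ᵥ decodeKet k = 1 := fun k => by simp [decodeKet]
    simp only [h, one_mul, decodeBra]
    rw [Fintype.sum_prod_type_right, Finset.sum_eq_single u.1]
    · by_cases huv : u.1 = v.1
      · have h2 : (if u = v then (1 : ℂ) else 0) = ((if u.2 = v.2 then 1 else 0 : ℝ) : ℂ) := by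
          by_cases h : u.2 = v.2 <;> simp [Prod.ext_iff, huv, h]
        have h3 := sum_readState false u.2 v.2
        have h4 := sum_readState true u.2 v.2
        have h5 : √2 * √2 = 2 := Real.mul_self_sqrt (by norm_num)
        rw [h2]
        simp only [← huv, if_true, Complex.star_def, Complex.conj_ofReal, ← Complex.ofReal_mul,
          ← Complex.ofReal_sum]
        congr 1
        rw [Fintype.sum_prod_type, Fintype.sum_bool]
        have h6 : ∀ b, ∑ w, readState (b, w) u.2 * (√2 / 2) * (readState (b, w) v.2 * (√2 / 2)) =
            1 / 2 * ∑ w, readState (b, w) u.2 * readState (b, w) v.2 := fun b => by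
          rw [Finset.mul_sum]
          refine Finset.sum_congr rfl fun w _ => ?_
          linear_combination (readState (b, w) u.2 * readState (b, w) v.2 / 4) * h5
        rw [h6, h6, h3, h4]
        ring
      · rw [if_neg fun h => huv (congrArg Prod.fst h)]
        exact Finset.sum_eq_zero fun k _ => by simp [Ne.symm huv]
    · intro s _ hs
      exact Finset.sum_eq_zero fun k _ => by simp [hs.symm]
    · simp

/-- The input is discarded, so only its trace survives. The factor `1/4` is the probability of each
pair of bits. -/
theorem encodeChannel_apply (ρ : Matrix ((Bool × Bool) × Bool) ((Bool × Bool) × Bool) ℂ)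
    (a a' : Bool × Bool) (m m' : Bool) :
    krausMap encodeChannel.op ρ (a, m) (a', m') =
      if a = a' then ((codeState a m * codeState a m' / 4 : ℝ) : ℂ) * ρ.trace else 0 := by
  refine (krausMap_rankOne_apply encodeKet encodeBra ρ (a, m) (a', m')).trans ?_
  have h : ∀ k : (Bool × Bool) × ((Bool × Bool) × Bool),
      ∑ u, ∑ v, star (encodeBra k u) * ρ u v * encodeBra k v = ρ k.2 k.2 := fun k => by
    simp only [encodeBra]
    rw [Finset.sum_eq_single k.2, Finset.sum_eq_single k.2]
    · simp
    · intro v _ hv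
      simp [hv]
    · simp
    · intro u _ hu
      simp [hu]
    · simp
  simp only [h, encodeKet]
  rw [Fintype.sum_prod_type, Finset.sum_eq_single a]
  · simp only [← Finset.mul_sum]
    change _ * ρ.trace = _
    by_cases ha : a = a'
    · simp only [← ha, if_true, Complex.star_def, Complex.conj_ofReal, ← Complex.ofReal_mul]
      congr 2
      ring
    · simp [ha, Ne.symm ha]
  · intro z _ hz
    exact Finset.sum_eq_zero fun k _ => by simp [hz.symm]
  · simp

theorem decodeChannel_apply (ρ : Matrix ((Bool × Bool) × Bool) ((Bool × Bool) × Bool) ℂ)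
    (s s' : Bool × Bool) (m m' : Bool) :
    krausMap decodeChannel.op ρ (s, m) (s', m') =
      if s = s' ∧ m = false ∧ m' = false then
        ∑ r, ∑ u, ∑ v, ((readState s u * readState s v / 2 : ℝ) : ℂ) * ρ (r, u) (r, v) else 0 := by
  refine (krausMap_rankOne_apply decodeKet decodeBra ρ (s, m) (s', m')).trans ?_
  have h : ∀ k : (Bool × Bool) × (Bool × Bool),
      ∑ u : (Bool × Bool) × Bool, ∑ v : (Bool × Bool) × Bool,
        star (decodeBra k u) * ρ u v * decodeBra k v =
      ∑ u, ∑ v, ((readState k.1 u * readState k.1 v / 2 : ℝ) : ℂ) * ρ (k.2, u) (k.2, v) :=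
      fun k => by
    have h5 : √2 * √2 = 2 := Real.mul_self_sqrt (by norm_num)
    simp only [decodeBra]
    rw [Fintype.sum_prod_type, Finset.sum_eq_single k.2]
    · refine Finset.sum_congr rfl fun u _ => ?_
      rw [Fintype.sum_prod_type, Finset.sum_eq_single k.2]
      · refine Finset.sum_congr rfl fun v _ => ?_
        simp only [if_true, Complex.star_def, Complex.conj_ofReal]
        rw [mul_right_comm, ← Complex.ofReal_mul]
        congr 2
        linear_combination (readState k.1 u * readState k.1 v / 4) * h5
      · intro r _ hr
        simp [hr]
      · simp
    · intro r _ hr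
      simp [hr]
    · simp
  simp only [h, decodeKet]
  rw [Fintype.sum_prod_type, Finset.sum_eq_single s]
  · simp only [← Finset.mul_sum]
    by_cases hs : s = s'
    · cases m <;> cases m' <;> simp [← hs]
    · simp [hs, Ne.symm hs, Prod.ext_iff]
  · intro r _ hr
    exact Finset.sum_eq_zero fun k _ => by simp [Ne.symm hr]
  · simp

/-- Alice sends two bits in a random access code, of which Bob reads one. -/
noncomputable def codeProtocol : Protocol 1 where
  rounds := 1
  M := Bool
  m₀ := false
  alice := { S := Bool × Bool, init := (false, false), move := fun _ => encodeChannel }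
  bob := { S := Bool × Bool, init := (false, false), move := fun _ => decodeChannel }
  aliceOut a := some (fun _ => a.1, fun _ => a.2)
  bobOut s := some (fun _ => s.1, fun _ => s.2)

theorem aliceStep_encodeChannel_single {B : Type} [Fintype B] [DecidableEq B]
    (a₀ a a' : Bool × Bool) (m₀ m m' : Bool) (b₀ b b' : B) :
    aliceStep encodeChannel (Matrix.single (a₀, m₀, b₀) (a₀, m₀, b₀) 1) (a, m, b) (a', m', b') =
      if a = a' ∧ b = b₀ ∧ b' = b₀ then ((codeState a m * codeState a m' / 4 : ℝ) : ℂ) else 0 := by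
  rw [aliceStep_apply, encodeChannel_apply]
  have h : (Matrix.of fun u v : (Bool × Bool) × Bool =>
      (Matrix.single (a₀, m₀, b₀) (a₀, m₀, b₀) 1 : Matrix (_ × _ × B) _ ℂ)
        (u.1, u.2, b) (v.1, v.2, b')).trace = if b = b₀ ∧ b' = b₀ then 1 else 0 := by
    rw [Matrix.trace, Finset.sum_eq_single (a₀, m₀)]
    · simp [Matrix.single_apply, eq_comm]
    · intro u _ hu
      simp only [Matrix.diag_apply, Matrix.of_apply, Matrix.single_apply, Prod.ext_iff]
      rw [if_neg]
      rintro ⟨⟨h1, h2, -⟩, -⟩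
      exact hu (Prod.ext (Prod.ext h1.1.symm h1.2.symm) h2.symm)
    · simp
  rw [h, mul_ite, mul_one, mul_zero]
  simp only [ite_and]

/-- The final state of the honest parties in `codeProtocol`. -/
noncomputable def codeFinal :
    Matrix ((Bool × Bool) × Bool × (Bool × Bool)) ((Bool × Bool) × Bool × (Bool × Bool)) ℂ :=
  bobStep decodeChannel (aliceStep encodeChannel (Matrix.single
    ((false, false), false, (false, false)) ((false, false), false, (false, false)) 1))

/-- The factor `1/8` comes from four equally likely pairs of Alice and two equally likely bases of
Bob; the message was reset to `false`. -/
theorem codeFinal_diag (x : (Bool × Bool) × Bool × (Bool × Bool)) :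
    codeFinal x x =
      (((if x.2.1 then 0 else
        if x.2.2.2 = (if x.2.2.1 then x.1.2 else x.1.1) then Real.cos (Real.pi / 8) ^ 2 / 8
          else Real.sin (Real.pi / 8) ^ 2 / 8) : ℝ) : ℂ) := by
  obtain ⟨a, m, s⟩ := x
  rw [codeFinal, bobStep_apply, decodeChannel_apply]
  simp only [Matrix.of_apply, aliceStep_encodeChannel_single]
  cases m
  · have h1 := sum_readState_codeState_sq a s
    simp only [and_self, true_and, if_true, Bool.false_eq_true, if_false, ← apply_ite (· / (8 : ℝ))]
    rw [← h1, Finset.sum_eq_single (false, false)]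
    · simp only [if_true, ← Complex.ofReal_mul, ← Complex.ofReal_sum]
      congr 1
      simp only [Fintype.sum_bool]
      ring
    · intro r _ hr
      simp [hr]
    · simp
  · simp

theorem prob_codeFinal (E : Set ((Bool × Bool) × Bool × (Bool × Bool)))
    [DecidablePred (· ∈ E)] :
    prob codeFinal E = ∑ a : Bool × Bool, ∑ s : Bool × Bool, if (a, false, s) ∈ E then
      if s.2 = (if s.1 then a.2 else a.1) then Real.cos (Real.pi / 8) ^ 2 / 8
        else Real.sin (Real.pi / 8) ^ 2 / 8 else 0 := by
  rw [prob, Fintype.sum_prod_type]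
  refine Finset.sum_congr rfl fun a _ => ?_
  rw [Fintype.sum_prod_type, Fintype.sum_bool]
  simp only [Set.indicator_apply, codeFinal_diag, Complex.ofReal_re]
  simp

theorem codeProtocol_isOT : codeProtocol.IsOT (Real.cos (Real.pi / 8) ^ 2) := by
  classical
  have hcs := Real.cos_sq_add_sin_sq (Real.pi / 8)
  have hb : ∀ c : Bits 1, ∀ a : Bool, (fun _ => a) = c ↔ a = c 0 := fun c a => by
    rw [← bits_one_eq c, funext_iff]
    simp
  constructor
  · have h := prob_codeFinal {x | some ((fun _ => x.1.1, fun _ => x.1.2) : Bits 1 × Bits 1) = none}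
    refine h.trans ?_
    simp
  · have h := prob_codeFinal
      {x | some ((fun _ => x.2.2.1, fun _ => x.2.2.2) : Bits 1 × Bits 1) = none}
    refine h.trans ?_
    simp
  · intro z
    have h := prob_codeFinal
      {x | some ((fun _ => x.1.1, fun _ => x.1.2) : Bits 1 × Bits 1) = some z}
    refine h.trans ?_
    have hz : ∀ a : Bool × Bool, (some ((fun _ => a.1, fun _ => a.2) : Bits 1 × Bits 1) = some z) =
        (a = (z.1 0, z.2 0)) := fun a => by
      simp only [Option.some.injEq, Prod.ext_iff, hb]
    simp only [Set.mem_ofPred_eq, hz]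
    generalize z.1 0 = z₀
    generalize z.2 0 = z₁
    cases z₀ <;> cases z₁ <;>
      simp [Fintype.sum_prod_type, -Real.cos_pi_div_eight, -Real.sin_pi_div_eight] <;> linarith
  · intro b
    have h := prob_codeFinal
      {x | ∃ w, some ((fun _ => x.2.2.1, fun _ => x.2.2.2) : Bits 1 × Bits 1) = some (b, w)}
    refine h.trans ?_
    have hz : ∀ s : Bool × Bool,
        (∃ w, some ((fun _ => s.1, fun _ => s.2) : Bits 1 × Bits 1) = some (b, w)) =
        (s.1 = b 0) := fun s => by
      simp only [Option.some.injEq, Prod.mk.injEq, hb, exists_and_left, eq_iff_iff]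
      exact ⟨fun h => h.1, fun h => ⟨h, fun _ => s.2, rfl⟩⟩
    simp only [Set.mem_ofPred_eq, hz]
    generalize b 0 = b₀
    cases b₀ <;>
      simp [Fintype.sum_prod_type, -Real.cos_pi_div_eight, -Real.sin_pi_div_eight] <;> linarith
  · have h := prob_codeFinal
      {x | ∃ z b, some ((fun _ => x.1.1, fun _ => x.1.2) : Bits 1 × Bits 1) = some z ∧
        some ((fun _ => x.2.2.1, fun _ => x.2.2.2) : Bits 1 × Bits 1) = some (b, select z b)}
    refine h.trans ?_
    have hz : ∀ a s : Bool × Bool,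
        (∃ z b, some ((fun _ => a.1, fun _ => a.2) : Bits 1 × Bits 1) = some z ∧
          some ((fun _ => s.1, fun _ => s.2) : Bits 1 × Bits 1) = some (b, select z b)) =
        (s.2 = if s.1 then a.2 else a.1) := fun a s => by
      simp only [Option.some.injEq, Prod.mk.injEq, eq_iff_iff]
      constructor
      · rintro ⟨z, b, rfl, rfl, h⟩
        exact congrFun h 0
      · exact fun h => ⟨_, fun _ => s.1, rfl, rfl, funext fun _ => h⟩
    simp only [Set.mem_ofPred_eq, hz]
    simp [Fintype.sum_prod_type, -Real.cos_pi_div_eight, -Real.sin_pi_div_eight]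
    linarith

/-- The point is that the right-hand side is free of `b`, for an arbitrary state `σ` that Alice may
have prepared. -/
theorem decodeChannel_hides {A : Type} [Fintype A] [DecidableEq A]
    (σ : Matrix (A × Bool × (Bool × Bool)) (A × Bool × (Bool × Bool)) ℂ) (b : Bool)
    (x x' : A) (m m' : Bool) :
    ∑ s : Bool × Bool with s.1 = b, bobStep decodeChannel σ (x, m, s) (x', m', s) =
      if m = false ∧ m' = false then ∑ r, ∑ u, ∑ v, ((if u = v then 1 / 2 else 0 : ℝ) : ℂ) *
        σ (x, u, r) (x', v, r) else 0 := by
  rw [Finset.sum_filter, Fintype.sum_prod_type, Finset.sum_eq_single b]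
  · simp only [if_true, bobStep_apply, decodeChannel_apply, Matrix.of_apply, true_and]
    split_ifs with hm
    · rw [Finset.sum_comm]
      refine Finset.sum_congr rfl fun r _ => ?_
      rw [Finset.sum_comm]
      refine Finset.sum_congr rfl fun u _ => ?_
      rw [Finset.sum_comm]
      refine Finset.sum_congr rfl fun v _ => ?_
      rw [← Finset.sum_mul, ← Complex.ofReal_sum, ← Finset.sum_div, sum_readState]
      congr 2
      split_ifs <;> norm_num
    · exact Finset.sum_const_zero
  · intro c _ hc
    simp [hc]
  · simp

/-- The point is that the right-hand side is free of `x`: before Bob's move, each value of the XOR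
leaves him the maximally mixed qubit with weight `1/2`. -/
theorem encodeChannel_hides {B : Type} [Fintype B] [DecidableEq B] (C : Channel (B × Bool))
    (b₀ : B) (x : Bool) (s s' : B) (m m' : Bool) :
    ∑ a : Bool × Bool with xor a.1 a.2 = x, bobStep C (aliceStep encodeChannel
        (Matrix.single ((false, false), false, b₀) ((false, false), false, b₀) 1))
        (a, m, s) (a, m', s') =
      krausMap C.op (Matrix.of fun u v => if u.1 = b₀ ∧ v.1 = b₀ then
        ((if u.2 = v.2 then 1 / 4 else 0 : ℝ) : ℂ) else 0) (s, m) (s', m') := by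
  simp only [bobStep_apply]
  rw [← Matrix.sum_apply, ← krausMap_sum]
  congr 2
  ext u v
  simp only [Matrix.sum_apply, Matrix.of_apply, aliceStep_encodeChannel_single, true_and]
  split_ifs with h h'
  · rw [← Complex.ofReal_sum, ← Finset.sum_div, sum_codeState_xor, if_pos h']
  · rw [← Complex.ofReal_sum, ← Finset.sum_div, sum_codeState_xor, if_neg h', zero_div]
  · exact Finset.sum_const_zero

theorem codeProtocol_aliceView (α : Strategy Bool) (b : Bits 1) (u v : α.S × Bool) :
    codeProtocol.aliceView α b u v = ∑ s : Bool × Bool with s.1 = b 0,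
      bobStep decodeChannel (aliceStep (α.move 0) (Matrix.single (α.init, false, (false, false))
        (α.init, false, (false, false)) 1)) (u.1, u.2, s) (v.1, v.2, s) := by
  have h : ∀ s : Bool × Bool, s.1 = b 0 ↔ some (fun _ => s.1) = some b := fun s => by
    rw [Option.some.injEq, ← bits_one_eq b, funext_iff]
    simp
  simp only [h]
  rfl

theorem codeProtocol_bobView (β : Strategy Bool) (x : Bits 1) (u v : β.S × Bool) :
    codeProtocol.bobView β x u v = ∑ a : Bool × Bool with xor a.1 a.2 = x 0,
      bobStep (β.move 0) (aliceStep encodeChannel (Matrix.single ((false, false), false, β.init)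
        ((false, false), false, β.init) 1)) (a, u.2, u.1) (a, v.2, v.1) := by
  have h : ∀ a : Bool × Bool, xor a.1 a.2 = x 0 ↔ some (fun _ => xor a.1 a.2) = some x :=
      fun a => by
    rw [Option.some.injEq, ← bits_one_eq x, funext_iff]
    simp
  simp only [h]
  rfl

theorem codeProtocol_isSecure : codeProtocol.IsSecure := by
  constructor
  · intro (α : Strategy Bool) b b'
    ext u v
    erw [codeProtocol_aliceView, codeProtocol_aliceView, decodeChannel_hides, decodeChannel_hides]
  · intro (β : Strategy Bool) x x'
    ext u v
    erw [codeProtocol_bobView, codeProtocol_bobView, encodeChannel_hides, encodeChannel_hides]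

end RandomAccessCode

/-! ### Unitary dilation of channels. -/

section Dilation

variable {X Y : Type} [Fintype X] [DecidableEq X] [Fintype Y] [DecidableEq Y]

/-- An isometry into a space that contains its domain extends to a unitary operator. -/
theorem exists_unitary_extension (V : Matrix Y X ℂ) (hV : Vᴴ * V = 1) (f : X → Y)
    (hf : Function.Injective f) :
    ∃ W : Matrix Y Y ℂ, Wᴴ * W = 1 ∧ ∀ y x, W y (f x) = V y x := by
  let c : X → EuclideanSpace ℂ Y := fun x => WithLp.toLp 2 fun y => V y x
  let v : Y → EuclideanSpace ℂ Y := Function.extend f c 0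
  have hv : ∀ x, v (f x) = c x := fun x => hf.extend_apply c 0 x
  have hc : ∀ x x', inner ℂ (c x) (c x') = if x = x' then (1 : ℂ) else 0 := fun x x' => by
    rw [← Matrix.one_apply, ← hV, EuclideanSpace.inner_toLp_toLp, Matrix.mul_apply, dotProduct]
    exact Finset.sum_congr rfl fun y _ => mul_comm _ _
  have ho : Orthonormal ℂ ((Set.range f).domRestrict v) := by
    rw [orthonormal_iff_ite]
    rintro ⟨_, x, rfl⟩ ⟨_, x', rfl⟩
    change inner ℂ (v (f x)) (v (f x')) = _
    rw [hv, hv, hc]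
    exact if_congr ⟨fun h => by simp only [h], fun h => hf (congrArg Subtype.val h)⟩ rfl rfl
  obtain ⟨b, hb⟩ := ho.exists_orthonormalBasis_extension_of_card_eq (by simp)
  refine ⟨Matrix.of fun y y' => b y' y, ?_, fun y x => ?_⟩
  · ext y y'
    rw [Matrix.one_apply, ← orthonormal_iff_ite.1 b.orthonormal y y', Matrix.mul_apply,
      EuclideanSpace.inner_eq_star_dotProduct, dotProduct]
    exact Finset.sum_congr rfl fun z _ => mul_comm _ _
  · rw [Matrix.of_apply, hb (f x) ⟨x, rfl⟩, hv]

noncomputable instance Channel.decidableEqIndex (C : Channel X) : DecidableEq C.κ :=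
  Classical.decEq _

/-- Stinespring: the Kraus operators stacked over their indices form an isometry. The extra point
`none` is a canonical initial state of the environment; the isometry never ends there. -/
theorem Channel.exists_dilation (C : Channel X) :
    ∃ W : Matrix (X × Option C.κ) (X × Option C.κ) ℂ, Wᴴ * W = 1 ∧
      (∀ x y, W (x, none) (y, none) = 0) ∧ ∀ x y k, W (x, some k) (y, none) = C.op k x y := by
  let V : Matrix (X × Option C.κ) X ℂ :=
    Matrix.of fun u y => u.2.elim 0 fun k => C.op k u.1 y
  have hV : Vᴴ * V = 1 := by
    rw [← C.trace_preserving]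
    ext y y'
    simp only [Matrix.mul_apply, Matrix.sum_apply, Matrix.conjTranspose_apply,
      Fintype.sum_prod_type_right, Fintype.sum_option, V, Matrix.of_apply, Option.elim_none,
      Option.elim_some, mul_zero, Finset.sum_const_zero, zero_add]
  obtain ⟨W, hW, h⟩ := exists_unitary_extension V hV (fun x => (x, none))
    fun x y h => congrArg Prod.fst h
  exact ⟨W, hW, fun x y => h _ _, fun x y k => h _ _⟩

/-- A unitary operator that implements the channel with an environment that starts in the state
`none` and records the index of the Kraus operator. -/
noncomputable def Channel.dilation (C : Channel X) :
    Matrix (X × Option C.κ) (X × Option C.κ) ℂ :=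
  C.exists_dilation.choose

/-- The channel given by the unitary dilation. -/
noncomputable def Channel.dilate (C : Channel X) (e : Y ≃ X × Option C.κ) : Channel Y where
  κ := Unit
  op _ := C.dilation.submatrix e e
  trace_preserving := by
    rw [Fintype.sum_unique, Matrix.conjTranspose_submatrix, Matrix.submatrix_mul_equiv,
      Channel.dilation, C.exists_dilation.choose_spec.1, Matrix.submatrix_one_equiv]

theorem Channel.dilate_op_none (C : Channel X) (e : Y ≃ X × Option C.κ) (k : Unit) (u v : Y)
    (hu : (e u).2 = none) (hv : (e v).2 = none) : (C.dilate e).op k u v = 0 := by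
  obtain ⟨⟨x, o⟩, rfl⟩ := e.symm.surjective u
  obtain ⟨⟨y, o'⟩, rfl⟩ := e.symm.surjective v
  simp only [Equiv.apply_symm_apply] at hu hv
  subst hu hv
  simpa [Channel.dilate, Channel.dilation] using C.exists_dilation.choose_spec.2.1 x y

theorem Channel.dilate_op_some (C : Channel X) (e : Y ≃ X × Option C.κ) (k : Unit) (u v : Y)
    (i : C.κ) (hu : (e u).2 = some i) (hv : (e v).2 = none) :
    (C.dilate e).op k u v = C.op i (e u).1 (e v).1 := by
  obtain ⟨⟨x, o⟩, rfl⟩ := e.symm.surjective u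
  obtain ⟨⟨y, o'⟩, rfl⟩ := e.symm.surjective v
  simp only [Equiv.apply_symm_apply] at hu hv
  subst hu hv
  simpa [Channel.dilate, Channel.dilation] using C.exists_dilation.choose_spec.2.2 x y i

end Dilation

/-! ### Partial traces and fresh environments. -/

section PartialTrace

variable {X Y Z κ : Type} [Fintype X] [DecidableEq X] [Fintype Y] [DecidableEq Y]
  [Fintype Z] [DecidableEq Z] [Fintype κ]

/-- The partial trace over the second factor. -/
def ptrace (e : Y ≃ X × Z) (ρ : Matrix Y Y ℂ) : Matrix X X ℂ :=
  ∑ z, block e z z ρ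

theorem ptrace_krausMap_liftOp (e : Y ≃ X × Z) (K : κ → Matrix X X ℂ) (ρ : Matrix Y Y ℂ) :
    ptrace e (krausMap (fun k => liftOp e (K k)) ρ) = krausMap K (ptrace e ρ) := by
  simp only [ptrace, block_krausMap_liftOp, krausMap_sum]

/-- The state `ρ'` is the product of `ρ` and the state `none` of the environment. -/
def IsFresh {O : Type} [DecidableEq O] (e : Y ≃ X × Option O) (ρ : Matrix X X ℂ)
    (ρ' : Matrix Y Y ℂ) : Prop :=
  ∀ z z', block e z z' ρ' = if z = none ∧ z' = none then ρ else 0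

variable {O : Type} [Fintype O] [DecidableEq O] {e : Y ≃ X × Option O} {ρ : Matrix X X ℂ}
  {ρ' : Matrix Y Y ℂ}

theorem IsFresh.ptrace_eq (h : IsFresh e ρ ρ') : ptrace e ρ' = ρ := by
  simp only [ptrace, h _ _, and_self]
  simp

theorem IsFresh.krausMap_liftOp (h : IsFresh e ρ ρ') (K : κ → Matrix X X ℂ) :
    IsFresh e (krausMap K ρ) (krausMap (fun k => liftOp e (K k)) ρ') := fun z z' => by
  rw [block_krausMap_liftOp, h]
  split_ifs
  · rfl
  · simp [krausMap]

theorem IsFresh.apply (h : IsFresh e ρ ρ') (u v : Y) :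
    ρ' u v = if (e u).2 = none ∧ (e v).2 = none then ρ (e u).1 (e v).1 else 0 := by
  have h' := congrFun (congrFun (h (e u).2 (e v).2) (e u).1) (e v).1
  simp only [block, Matrix.of_apply, Prod.mk.eta, Equiv.symm_apply_apply] at h'
  rw [h']
  split_ifs <;> rfl

/-- On a fresh environment only the columns of `W` with index `none` matter. The trace over the
environment sums over its final state, and each `k` contributes exactly the term of the `k`-th Kraus
operator. -/
theorem IsFresh.ptrace_dilation (h : IsFresh e ρ ρ') (K : O → Matrix X X ℂ)
    {ι : Type} [Fintype ι] [Unique ι] (W : ι → Matrix Y Y ℂ)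
    (h0 : ∀ i x y, W i (e.symm (x, none)) (e.symm (y, none)) = 0)
    (h1 : ∀ i x y k, W i (e.symm (x, some k)) (e.symm (y, none)) = K k x y) :
    ptrace e (krausMap W ρ') = krausMap K ρ := by
  have hb : ∀ z, block e z z (krausMap W ρ') =
      (Matrix.of fun x y => W default (e.symm (x, z)) (e.symm (y, none))) * ρ *
        (Matrix.of fun x y => W default (e.symm (x, z)) (e.symm (y, none)))ᴴ := fun z => by
    ext x y
    simp only [block, krausMap, Fintype.sum_unique, Matrix.mul_apply, Matrix.of_apply,
      Matrix.conjTranspose_apply]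
    rw [← e.symm.sum_comp, Fintype.sum_prod_type]
    refine Finset.sum_congr rfl fun v _ => ?_
    rw [Finset.sum_eq_single none]
    · congr 1
      rw [← e.symm.sum_comp, Fintype.sum_prod_type]
      refine Finset.sum_congr rfl fun u _ => ?_
      rw [Finset.sum_eq_single none]
      · rw [h.apply]; simp
      · intro w _ hw
        rw [h.apply]; simp [hw]
      · simp
    · intro w _ hw
      rw [Finset.sum_eq_zero, zero_mul]
      intro u _
      rw [h.apply]; simp [hw]
    · simp
  simp only [ptrace, hb, Fintype.sum_option, h0, h1]
  rw [show (Matrix.of fun _ _ => 0 : Matrix X X ℂ) = 0 from rfl, Matrix.zero_mul, Matrix.zero_mul,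
    zero_add]
  rfl

theorem isFresh_single (x : X) (y : Y) (hy : e y = (x, none)) :
    IsFresh e (Matrix.single x x 1) (Matrix.single y y 1) := fun z z' => by
  obtain rfl : y = e.symm (x, none) := by rw [← hy, Equiv.symm_apply_apply]
  ext u v
  simp only [block, Matrix.of_apply, Matrix.single_apply, EmbeddingLike.apply_eq_iff_eq,
    Prod.mk.injEq, @eq_comm _ none]
  split_ifs <;> simp_all [Matrix.single_apply]
  exact ‹x = u ∧ x = v›.1.symm.trans ‹x = u ∧ x = v›.2

end PartialTrace

/-! ### Purification of strategies, one round at a time. -/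

section Purify

variable {M : Type} [Fintype M] [DecidableEq M]

/-- The environment of a private register, taken apart. -/
def envEquiv {S M O : Type} : (S × O) × M ≃ (S × M) × O where
  toFun x := ((x.1.1, x.2), x.1.2)
  invFun y := ((y.1.1, y.2), y.1.2)
  left_inv _ := rfl
  right_inv _ := rfl

/-- The environment of Alice's register, taken apart. -/
def aliceEnv {A M B O : Type} : (A × O) × M × B ≃ (A × M × B) × O where
  toFun x := ((x.1.1, x.2), x.1.2)
  invFun y := ((y.1.1, y.2), y.1.2)
  left_inv _ := rfl
  right_inv _ := rfl

/-- The environment of Bob's register, taken apart. -/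
def bobEnv {A M B O : Type} : A × M × (B × O) ≃ (A × M × B) × O where
  toFun x := ((x.1, x.2.1, x.2.2.1), x.2.2.2)
  invFun y := (y.1.1, y.1.2.1, (y.1.2.2, y.2))
  left_inv _ := rfl
  right_inv _ := rfl

/-- The strategy `σ` with round `T` performed by a unitary operator. -/
noncomputable def Strategy.purifyRound (σ : Strategy M) (T : ℕ) : Strategy M where
  S := σ.S × Option (σ.move T).κ
  init := (σ.init, none)
  move t := if t = T then (σ.move T).dilate envEquiv else (σ.move t).lift envEquiv

theorem Strategy.purifyRound_move_self (σ : Strategy M) (T : ℕ) :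
    (σ.purifyRound T).move T = (σ.move T).dilate envEquiv := if_pos rfl

theorem Strategy.purifyRound_move_of_ne (σ : Strategy M) {t T : ℕ} (h : t ≠ T) :
    (σ.purifyRound T).move t = (σ.move t).lift envEquiv := if_neg h

variable {A B O : Type} [Fintype A] [DecidableEq A] [Fintype B] [DecidableEq B]
  [Fintype O] [DecidableEq O]

theorem onAlice_bobEnv (K : Matrix (A × M) (A × M) ℂ) :
    (onAlice K : Matrix (A × M × (B × O)) _ ℂ) = liftOp bobEnv (onAlice K) := by
  ext x y
  simp only [onAlice, liftOp_apply, Matrix.of_apply, bobEnv, Equiv.coe_fn_mk, Prod.ext_iff]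
  split_ifs <;> simp_all

theorem onBob_aliceEnv (K : Matrix (B × M) (B × M) ℂ) :
    (onBob K : Matrix ((A × O) × M × B) _ ℂ) = liftOp aliceEnv (onBob K) := by
  ext x y
  simp only [onBob, liftOp_apply, Matrix.of_apply, aliceEnv, Equiv.coe_fn_mk, Prod.ext_iff]
  split_ifs <;> simp_all

theorem onBob_liftOp_envEquiv (K : Matrix (B × M) (B × M) ℂ) :
    (onBob (liftOp envEquiv K) : Matrix (A × M × (B × O)) _ ℂ) = liftOp bobEnv (onBob K) := by
  ext x y
  simp only [onBob, liftOp_apply, Matrix.of_apply, bobEnv, envEquiv, Equiv.coe_fn_mk]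
  split_ifs <;> simp_all

theorem onAlice_liftOp_envEquiv (K : Matrix (A × M) (A × M) ℂ) :
    (onAlice (liftOp envEquiv K) : Matrix ((A × O) × M × B) _ ℂ) =
      liftOp aliceEnv (onAlice K) := by
  ext x y
  simp only [onAlice, liftOp_apply, Matrix.of_apply, aliceEnv, envEquiv, Equiv.coe_fn_mk]
  split_ifs <;> simp_all

theorem bobStep_dilate (C : Channel (B × M)) {ρ : Matrix (A × M × B) (A × M × B) ℂ}
    {ρ' : Matrix (A × M × (B × Option C.κ)) (A × M × (B × Option C.κ)) ℂ}
    (h : IsFresh bobEnv ρ ρ') :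
    ptrace bobEnv (bobStep (C.dilate envEquiv) ρ') = bobStep C ρ := by
  refine h.ptrace_dilation (fun k => onBob (C.op k)) (ι := Unit)
    (fun k => onBob ((C.dilate envEquiv).op k)) (fun i x y => ?_) (fun i x y k => ?_)
  · simp only [onBob, Matrix.of_apply, bobEnv, Equiv.coe_fn_symm_mk]
    split_ifs
    · exact C.dilate_op_none envEquiv i _ _ rfl rfl
    · rfl
  · simp only [onBob, Matrix.of_apply, bobEnv, Equiv.coe_fn_symm_mk]
    split_ifs
    · exact C.dilate_op_some envEquiv i _ _ k rfl rfl
    · rfl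

theorem aliceStep_dilate (C : Channel (A × M)) {ρ : Matrix (A × M × B) (A × M × B) ℂ}
    {ρ' : Matrix ((A × Option C.κ) × M × B) ((A × Option C.κ) × M × B) ℂ}
    (h : IsFresh aliceEnv ρ ρ') :
    ptrace aliceEnv (aliceStep (C.dilate envEquiv) ρ') = aliceStep C ρ := by
  refine h.ptrace_dilation (fun k => onAlice (C.op k)) (ι := Unit)
    (fun k => onAlice ((C.dilate envEquiv).op k)) (fun i x y => ?_) (fun i x y k => ?_)
  · simp only [onAlice, Matrix.of_apply, aliceEnv, Equiv.coe_fn_symm_mk]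
    split_ifs
    · exact C.dilate_op_none envEquiv i _ _ rfl rfl
    · rfl
  · simp only [onAlice, Matrix.of_apply, aliceEnv, Equiv.coe_fn_symm_mk]
    split_ifs
    · exact C.dilate_op_some envEquiv i _ _ k rfl rfl
    · rfl

theorem aliceStep_bobEnv (C : Channel (A × M)) (ρ : Matrix (A × M × (B × O)) (A × M × (B × O)) ℂ) :
    aliceStep C ρ = krausMap (fun k => liftOp bobEnv (onAlice (C.op k))) ρ := by
  simp only [aliceStep_eq, onAlice_bobEnv]

theorem IsFresh.aliceStep_bobEnv (C : Channel (A × M))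
    {ρ : Matrix (A × M × B) (A × M × B) ℂ} {ρ' : Matrix (A × M × (B × Option O)) (A × M × (B × Option O)) ℂ}
    (h : IsFresh bobEnv ρ ρ') : IsFresh bobEnv (aliceStep C ρ) (aliceStep C ρ') := by
  rw [QOT.aliceStep_bobEnv]
  exact h.krausMap_liftOp _

theorem ptrace_aliceStep_bobEnv (C : Channel (A × M))
    {ρ : Matrix (A × M × B) (A × M × B) ℂ} {ρ' : Matrix (A × M × (B × O)) (A × M × (B × O)) ℂ}
    (h : ptrace bobEnv ρ' = ρ) : ptrace bobEnv (aliceStep C ρ') = aliceStep C ρ := by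
  rw [aliceStep_bobEnv, ptrace_krausMap_liftOp, h]
  rfl

theorem bobStep_aliceEnv (C : Channel (B × M)) (ρ : Matrix ((A × O) × M × B) ((A × O) × M × B) ℂ) :
    bobStep C ρ = krausMap (fun k => liftOp aliceEnv (onBob (C.op k))) ρ := by
  simp only [bobStep_eq, onBob_aliceEnv]

theorem IsFresh.bobStep_aliceEnv (C : Channel (B × M))
    {ρ : Matrix (A × M × B) (A × M × B) ℂ} {ρ' : Matrix ((A × Option O) × M × B) ((A × Option O) × M × B) ℂ}
    (h : IsFresh aliceEnv ρ ρ') : IsFresh aliceEnv (bobStep C ρ) (bobStep C ρ') := by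
  rw [QOT.bobStep_aliceEnv]
  exact h.krausMap_liftOp _

theorem ptrace_bobStep_aliceEnv (C : Channel (B × M))
    {ρ : Matrix (A × M × B) (A × M × B) ℂ} {ρ' : Matrix ((A × O) × M × B) ((A × O) × M × B) ℂ}
    (h : ptrace aliceEnv ρ' = ρ) : ptrace aliceEnv (bobStep C ρ') = bobStep C ρ := by
  rw [bobStep_aliceEnv, ptrace_krausMap_liftOp, h]
  rfl

theorem bobStep_lift_bobEnv (C : Channel (B × M)) (ρ : Matrix (A × M × (B × O)) (A × M × (B × O)) ℂ) :
    bobStep (C.lift envEquiv) ρ = krausMap (fun k => liftOp bobEnv (onBob (C.op k))) ρ := by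
  simp only [bobStep_eq, ← onBob_liftOp_envEquiv]
  rfl

theorem IsFresh.bobStep_lift_bobEnv (C : Channel (B × M))
    {ρ : Matrix (A × M × B) (A × M × B) ℂ} {ρ' : Matrix (A × M × (B × Option O)) (A × M × (B × Option O)) ℂ}
    (h : IsFresh bobEnv ρ ρ') : IsFresh bobEnv (bobStep C ρ) (bobStep (C.lift envEquiv) ρ') := by
  rw [QOT.bobStep_lift_bobEnv]
  exact h.krausMap_liftOp _

theorem ptrace_bobStep_lift_bobEnv (C : Channel (B × M))
    {ρ : Matrix (A × M × B) (A × M × B) ℂ} {ρ' : Matrix (A × M × (B × O)) (A × M × (B × O)) ℂ}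
    (h : ptrace bobEnv ρ' = ρ) : ptrace bobEnv (bobStep (C.lift envEquiv) ρ') = bobStep C ρ := by
  rw [bobStep_lift_bobEnv, ptrace_krausMap_liftOp, h]
  rfl

theorem aliceStep_lift_aliceEnv (C : Channel (A × M)) (ρ : Matrix ((A × O) × M × B) ((A × O) × M × B) ℂ) :
    aliceStep (C.lift envEquiv) ρ = krausMap (fun k => liftOp aliceEnv (onAlice (C.op k))) ρ := by
  simp only [aliceStep_eq, ← onAlice_liftOp_envEquiv]
  rfl

theorem IsFresh.aliceStep_lift_aliceEnv (C : Channel (A × M))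
    {ρ : Matrix (A × M × B) (A × M × B) ℂ} {ρ' : Matrix ((A × Option O) × M × B) ((A × Option O) × M × B) ℂ}
    (h : IsFresh aliceEnv ρ ρ') : IsFresh aliceEnv (aliceStep C ρ) (aliceStep (C.lift envEquiv) ρ') := by
  rw [QOT.aliceStep_lift_aliceEnv]
  exact h.krausMap_liftOp _

theorem ptrace_aliceStep_lift_aliceEnv (C : Channel (A × M))
    {ρ : Matrix (A × M × B) (A × M × B) ℂ} {ρ' : Matrix ((A × O) × M × B) ((A × O) × M × B) ℂ}
    (h : ptrace aliceEnv ρ' = ρ) : ptrace aliceEnv (aliceStep (C.lift envEquiv) ρ') = aliceStep C ρ := by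
  rw [aliceStep_lift_aliceEnv, ptrace_krausMap_liftOp, h]
  rfl

/-- All moves before round `T` act trivially on the new environment. -/
theorem isFresh_jointState_purifyRound_bob (m₀ : M) (α σ : Strategy M) (T t : ℕ) (ht : t ≤ T) :
    IsFresh bobEnv (jointState m₀ α σ t) (jointState m₀ α (σ.purifyRound T) t) := by
  induction t with
  | zero => exact isFresh_single _ _ rfl
  | succ t ih =>
    simp only [jointState]
    rw [σ.purifyRound_move_of_ne (by omega : t ≠ T)]
    exact ((ih (by omega)).aliceStep_bobEnv _).bobStep_lift_bobEnv _

/-- Freshness is needed only at round `T`, where the dilation acts. Later moves leave the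
environment alone and so commute with tracing it out. -/
theorem ptrace_jointState_purifyRound_bob (m₀ : M) (α σ : Strategy M) (T t : ℕ) :
    ptrace bobEnv (jointState m₀ α (σ.purifyRound T) t) = jointState m₀ α σ t := by
  induction t with
  | zero => exact (isFresh_jointState_purifyRound_bob m₀ α σ T 0 (Nat.zero_le _)).ptrace_eq
  | succ t ih =>
    simp only [jointState]
    by_cases ht : t = T
    · subst ht
      rw [σ.purifyRound_move_self]
      exact bobStep_dilate _
        ((isFresh_jointState_purifyRound_bob m₀ α σ t t le_rfl).aliceStep_bobEnv _)
    · rw [σ.purifyRound_move_of_ne ht]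
      exact ptrace_bobStep_lift_bobEnv _ (ptrace_aliceStep_bobEnv _ ih)

theorem isFresh_jointState_purifyRound_alice (m₀ : M) (σ β : Strategy M) (T t : ℕ) (ht : t ≤ T) :
    IsFresh aliceEnv (jointState m₀ σ β t) (jointState m₀ (σ.purifyRound T) β t) := by
  induction t with
  | zero => exact isFresh_single _ _ rfl
  | succ t ih =>
    simp only [jointState]
    rw [σ.purifyRound_move_of_ne (by omega : t ≠ T)]
    exact ((ih (by omega)).aliceStep_lift_aliceEnv _).bobStep_aliceEnv _

theorem ptrace_jointState_purifyRound_alice (m₀ : M) (σ β : Strategy M) (T t : ℕ) :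
    ptrace aliceEnv (jointState m₀ (σ.purifyRound T) β t) = jointState m₀ σ β t := by
  induction t with
  | zero => exact (isFresh_jointState_purifyRound_alice m₀ σ β T 0 (Nat.zero_le _)).ptrace_eq
  | succ t ih =>
    simp only [jointState]
    refine ptrace_bobStep_aliceEnv _ ?_
    by_cases ht : t = T
    · subst ht
      rw [σ.purifyRound_move_self]
      exact aliceStep_dilate _ (isFresh_jointState_purifyRound_alice m₀ σ β t t le_rfl)
    · rw [σ.purifyRound_move_of_ne ht]
      exact ptrace_aliceStep_lift_aliceEnv _ ih

/-- Bob's strategy can be replaced by one with unitary moves in the first `T` rounds, without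
changing anything for Alice. -/
theorem exists_pure_bob (m₀ : M) (σ : Strategy M) (T : ℕ) :
    ∃ (σ' : Strategy M) (f : σ'.S → σ.S), (∀ t < T, Nonempty (Unique (σ'.move t).κ)) ∧
      ∀ (α : Strategy M) (t : ℕ) (p : σ.S → Prop) [DecidablePred p] (a a' : α.S) (m m' : M),
        ∑ s with p s, jointState m₀ α σ t (a, m, s) (a', m', s) =
          ∑ s with p (f s), jointState m₀ α σ' t (a, m, s) (a', m', s) := by
  induction T with
  | zero => exact ⟨σ, id, by simp, fun _ _ _ _ _ _ _ _ => rfl⟩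
  | succ T ih =>
    obtain ⟨σ', f, hσ', hf⟩ := ih
    -- The earlier rounds stay unitary, since lifting to the larger register keeps the single Kraus
    -- operator; outputs are read off without the environment.
    refine ⟨σ'.purifyRound T, fun s => f s.1, fun t ht => ?_, fun α t p _ a a' m m' => ?_⟩
    · by_cases h : t = T
      · subst h
        rw [σ'.purifyRound_move_self]
        exact ⟨inferInstanceAs (Unique Unit)⟩
      · rw [σ'.purifyRound_move_of_ne h]
        exact hσ' t (by omega)
    · rw [hf, Finset.sum_filter, Finset.sum_filter]
      refine Eq.trans ?_ (Fintype.sum_prod_type (α₁ := σ'.S) (α₂ := Option (σ'.move T).κ) _).symm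
      refine Finset.sum_congr rfl fun s _ => ?_
      dsimp only
      split_ifs
      · exact (congrFun (congrFun (ptrace_jointState_purifyRound_bob m₀ α σ' T t).symm _) _).trans
          (Matrix.sum_apply _ _ _ _)
      · simp

/-- Alice's strategy can be replaced by one with unitary moves in the first `T` rounds, without
changing anything for Bob. -/
theorem exists_pure_alice (m₀ : M) (σ : Strategy M) (T : ℕ) :
    ∃ (σ' : Strategy M) (f : σ'.S → σ.S), (∀ t < T, Nonempty (Unique (σ'.move t).κ)) ∧
      ∀ (β : Strategy M) (t : ℕ) (p : σ.S → Prop) [DecidablePred p] (b b' : β.S) (m m' : M),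
        ∑ s with p s, jointState m₀ σ β t (s, m, b) (s, m', b') =
          ∑ s with p (f s), jointState m₀ σ' β t (s, m, b) (s, m', b') := by
  induction T with
  | zero => exact ⟨σ, id, by simp, fun _ _ _ _ _ _ _ _ => rfl⟩
  | succ T ih =>
    obtain ⟨σ', f, hσ', hf⟩ := ih
    refine ⟨σ'.purifyRound T, fun s => f s.1, fun t ht => ?_, fun α t p _ a a' m m' => ?_⟩
    · by_cases h : t = T
      · subst h
        rw [σ'.purifyRound_move_self]
        exact ⟨inferInstanceAs (Unique Unit)⟩
      · rw [σ'.purifyRound_move_of_ne h]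
        exact hσ' t (by omega)
    · rw [hf, Finset.sum_filter, Finset.sum_filter]
      refine Eq.trans ?_ (Fintype.sum_prod_type (α₁ := σ'.S) (α₂ := Option (σ'.move T).κ) _).symm
      refine Finset.sum_congr rfl fun s _ => ?_
      dsimp only
      split_ifs
      · exact (congrFun (congrFun (ptrace_jointState_purifyRound_alice m₀ σ' α T t).symm _) _).trans
          (Matrix.sum_apply _ _ _ _)
      · simp

theorem krausMap_unique_vecMulVec {X κ : Type} [Fintype X] [Fintype κ] [Unique κ]
    (K : κ → Matrix X X ℂ) (ψ : X → ℂ) :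
    krausMap K (vecMulVec ψ (star ψ)) =
      vecMulVec (K default *ᵥ ψ) (star (K default *ᵥ ψ)) := by
  rw [krausMap, Fintype.sum_unique, Matrix.mul_vecMulVec, Matrix.vecMulVec_mul,
    Matrix.star_mulVec]

/-- A channel with a single Kraus operator maps vector states to vector states. -/
theorem jointState_pure (m₀ : M) (α β : Strategy M) (T : ℕ)
    (hα : ∀ t < T, Nonempty (Unique (α.move t).κ)) (hβ : ∀ t < T, Nonempty (Unique (β.move t).κ)) :
    ∃ ψ, jointState m₀ α β T = vecMulVec ψ (star ψ) := by
  induction T with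
  | zero =>
    refine ⟨Pi.single (α.init, m₀, β.init) 1, ?_⟩
    simp only [jointState]
    rw [← Pi.single_star, star_one, ← Matrix.single_eq_single_vecMulVec_single]
  | succ T ih =>
    obtain ⟨ψ, hψ⟩ := ih (fun t ht => hα t (by omega)) fun t ht => hβ t (by omega)
    obtain ⟨hA⟩ := hα T (by omega)
    obtain ⟨hB⟩ := hβ T (by omega)
    refine ⟨onBob ((β.move T).op default) *ᵥ (onAlice ((α.move T).op default) *ᵥ ψ), ?_⟩
    simp only [jointState]
    rw [aliceStep_eq, bobStep_eq, hψ, krausMap_unique_vecMulVec, krausMap_unique_vecMulVec]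

end Purify

/-! ### The norm estimate behind the quantum bias of CHSH. -/

section Hadamard

variable {n : ℕ}

/-- The sign `-1` for the bit `1`. -/
def bitSign (b : Bool) : ℝ := if b then -1 else 1

/-- The entries of a tensor product of Hadamard matrices, at the positions in `S`, and of matrices
with all entries `1`. -/
def hadamard (S : Finset (Fin n)) (x b : Bits n) : ℝ := ∏ i ∈ S, bitSign (x i && b i)

theorem hadamard_eq_prod_univ (S : Finset (Fin n)) (x b : Bits n) :
    hadamard S x b = ∏ i, if i ∈ S then bitSign (x i && b i) else 1 := by
  rw [Finset.prod_ite_mem, Finset.univ_inter, hadamard]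

theorem sum_prod_bits (f : Fin n → Bool → ℝ) :
    ∑ x : Bits n, ∏ i, f i (x i) = ∏ i, (f i true + f i false) := by
  simp only [← Fintype.sum_bool, Finset.prod_univ_sum, Fintype.piFinset_univ]

/-- The sum factors over the positions: a position in `S` gives `2` or, by orthogonality of Hadamard
rows, `0`; any other gives `2`. Nonnegative coefficients allow inner products to be replaced by
upper bounds below. -/
theorem sum_hadamard_mul_nonneg (S : Finset (Fin n)) (x x' : Bits n) :
    0 ≤ ∑ b, hadamard S x b * hadamard S x' b := by
  simp only [hadamard_eq_prod_univ, ← Finset.prod_mul_distrib]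
  rw [sum_prod_bits fun i q => (if i ∈ S then bitSign (x i && q) else 1) *
    (if i ∈ S then bitSign (x' i && q) else 1)]
  refine Finset.prod_nonneg fun i _ => ?_
  by_cases h : i ∈ S <;> cases x i <;> cases x' i <;> simp [h, bitSign]

/-- Each position in `S` contributes `4`, each other one `8`. -/
theorem sum_sum_hadamard_mul (S : Finset (Fin n)) :
    ∑ x, ∑ x', ∑ b, hadamard S x b * hadamard S x' b = 8 ^ n * (1 / 2) ^ S.card := by
  have h : ∀ x x' : Bits n, ∑ b, hadamard S x b * hadamard S x' b =
      ∏ i, ((if i ∈ S then bitSign (x i && true) else 1) *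
          (if i ∈ S then bitSign (x' i && true) else 1) +
        (if i ∈ S then bitSign (x i && false) else 1) *
          (if i ∈ S then bitSign (x' i && false) else 1)) := fun x x' => by
    simp only [hadamard_eq_prod_univ, ← Finset.prod_mul_distrib]
    exact sum_prod_bits fun i q => (if i ∈ S then bitSign (x i && q) else 1) *
      (if i ∈ S then bitSign (x' i && q) else 1)
  simp only [h]
  have h' : ∀ x : Bits n, _ := fun x => sum_prod_bits fun i p' =>
    (if i ∈ S then bitSign (x i && true) else 1) * (if i ∈ S then bitSign (p' && true) else 1) +
      (if i ∈ S then bitSign (x i && false) else 1) * (if i ∈ S then bitSign (p' && false) else 1)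
  simp only [h']
  refine (sum_prod_bits fun i p =>
    ((if i ∈ S then bitSign (p && true) else 1) * (if i ∈ S then bitSign (true && true) else 1) +
      (if i ∈ S then bitSign (p && false) else 1) *
        (if i ∈ S then bitSign (true && false) else 1)) +
    ((if i ∈ S then bitSign (p && true) else 1) * (if i ∈ S then bitSign (false && true) else 1) +
      (if i ∈ S then bitSign (p && false) else 1) *
        (if i ∈ S then bitSign (false && false) else 1))).trans ?_
  rw [show (8 : ℝ) ^ n * (1 / 2) ^ S.card = ∏ i : Fin n, (8 * if i ∈ S then 1 / 2 else 1) by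
    rw [Finset.prod_mul_distrib, Finset.prod_ite_mem, Finset.univ_inter, Finset.prod_const,
      Finset.prod_const, Finset.card_univ, Fintype.card_fin]]
  refine Finset.prod_congr rfl fun i _ => ?_
  by_cases h : i ∈ S <;> simp [h, bitSign] <;> norm_num

/-- The operator norm of this sign matrix is `√2^|S| 2^(n - |S|)`, and there are `2ⁿ` vectors of
squared norm at most `N` on each side. The proof sums over `x` to get the vectors `g b`, bounds
their total squared norm through the Gram matrix of the rows, and applies a weighted Cauchy
inequality. -/
theorem sum_hadamard_inner_le {E : Type*} [NormedAddCommGroup E] [InnerProductSpace ℝ E]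
    (S : Finset (Fin n)) (u v : Bits n → E) (N : ℝ) (hu : ∀ x, ‖u x‖ ^ 2 ≤ N)
    (hv : ∀ b, ‖v b‖ ^ 2 ≤ N) :
    ∑ x, ∑ b, hadamard S x b * inner ℝ (u x) (v b) ≤ 4 ^ n * (√2 / 2) ^ S.card * N := by
  let g : Bits n → E := fun b => ∑ x, hadamard S x b • u x
  have hin : ∀ x x', inner ℝ (u x) (u x') ≤ N := fun x x' => by
    have h1 := real_inner_le_norm (u x) (u x')
    nlinarith [sq_nonneg (‖u x‖ - ‖u x'‖), hu x, hu x']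
  have hg : ∑ b, ‖g b‖ ^ 2 ≤ 8 ^ n * (1 / 2) ^ S.card * N := by
    have h1 : ∀ b, ‖g b‖ ^ 2 =
        ∑ x, ∑ x', hadamard S x b * hadamard S x' b * inner ℝ (u x) (u x') := fun b => by
      rw [← real_inner_self_eq_norm_sq]
      simp only [g, sum_inner, inner_sum, real_inner_smul_left, real_inner_smul_right]
      exact Finset.sum_congr rfl fun _ _ => Finset.sum_congr rfl fun _ _ => by
        rw [real_inner_comm]; ring
    simp only [h1]
    rw [Finset.sum_comm]
    have h2 : ∀ x, ∑ b, ∑ x', hadamard S x b * hadamard S x' b * inner ℝ (u x) (u x') =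
        ∑ x', (∑ b, hadamard S x b * hadamard S x' b) * inner ℝ (u x) (u x') := fun x => by
      rw [Finset.sum_comm]
      simp only [Finset.sum_mul]
    simp only [h2]
    rw [← sum_sum_hadamard_mul, Finset.sum_mul]
    refine Finset.sum_le_sum fun x _ => ?_
    rw [Finset.sum_mul]
    exact Finset.sum_le_sum fun x' _ =>
      mul_le_mul_of_nonneg_left (hin x x') (sum_hadamard_mul_nonneg S x x')
  set s : ℝ := √2 ^ S.card with hs
  have hs0 : 0 < s := by positivity
  have hs2 : s * s = 2 ^ S.card := by
    rw [hs, ← mul_pow, Real.mul_self_sqrt (by norm_num)]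
  have h1 : (1 / 2 : ℝ) ^ S.card = 1 / (s * s) := by rw [hs2, _root_.one_div_pow]
  have h2 : (√2 / 2) ^ S.card = 1 / s := by
    rw [div_pow, ← hs, ← hs2]
    field_simp
  have h4 : (4 : ℝ) ^ n = 2 ^ n * 2 ^ n := by rw [← mul_pow]; norm_num
  have h8 : (8 : ℝ) ^ n = 2 ^ n * 2 ^ n * 2 ^ n := by rw [← mul_pow, ← mul_pow]; norm_num
  have h20 : (0 : ℝ) < 2 ^ n := by positivity
  have hcard : (Fintype.card (Bits n) : ℝ) = 2 ^ n := by simp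
  rw [h1, h8] at hg
  rw [h2, h4, Finset.sum_comm]
  generalize (2 : ℝ) ^ n = k at *
  -- With `k = 2ⁿ` and `s = √2^|S|`, the bound on the mean of `‖g b‖ ^ 2` is `(k/s)² N`; the weights
  -- `s/k` and `k/s` make the two terms equal in that case, so nothing is lost.
  have hb : ∀ b, ∑ x, hadamard S x b * inner ℝ (u x) (v b) ≤
      (s / k * ‖g b‖ ^ 2 + k / s * N) / 2 := fun b => by
    have h5 : ∑ x, hadamard S x b * inner ℝ (u x) (v b) = inner ℝ (g b) (v b) := by
      simp only [g, sum_inner, real_inner_smul_left]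
    rw [h5]
    have h6 := real_inner_le_norm (g b) (v b)
    have h7 : ‖g b‖ * ‖v b‖ ≤ (s / k * ‖g b‖ ^ 2 + k / s * ‖v b‖ ^ 2) / 2 := by
      have h8 : 0 ≤ (s * ‖g b‖ - k * ‖v b‖) ^ 2 / (s * k) := by positivity
      have h9 : (s * ‖g b‖ - k * ‖v b‖) ^ 2 / (s * k) =
          s / k * ‖g b‖ ^ 2 + k / s * ‖v b‖ ^ 2 - 2 * (‖g b‖ * ‖v b‖) := by
        field_simp
        ring
      linarith
    have h10 : k / s * ‖v b‖ ^ 2 ≤ k / s * N := mul_le_mul_of_nonneg_left (hv b) (by positivity)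
    linarith
  refine (Finset.sum_le_sum fun b _ => hb b).trans ?_
  rw [← Finset.sum_div, Finset.sum_add_distrib, ← Finset.mul_sum, Finset.sum_const,
    Finset.card_univ, nsmul_eq_mul, hcard]
  have h5 := mul_le_mul_of_nonneg_left hg (show 0 ≤ s / k by positivity)
  have h6 : s / k * (k * k * k * (1 / (s * s)) * N) = k * k * (1 / s) * N := by field_simp
  have h7 : k * (k / s * N) = k * k * (1 / s) * N := by field_simp
  linarith

end Hadamard

/-! ### Unitary equivalence of purifications. -/

section Uhlmann

variable {X Y : Type} [Fintype X] [DecidableEq X] [Fintype Y] [DecidableEq Y]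

theorem inner_toEuclideanLin (Φ Ψ : Matrix X Y ℂ) (v w : EuclideanSpace ℂ Y) :
    inner ℂ (Matrix.toEuclideanLin Φ v) (Matrix.toEuclideanLin Ψ w) =
      inner ℂ v (Matrix.toEuclideanLin (Φᴴ * Ψ) w) := by
  rw [← LinearMap.adjoint_inner_right, ← Matrix.toEuclideanLin_conjTranspose_eq_adjoint]
  congr 1
  simp [Matrix.toEuclideanLin, Matrix.toLpLin_apply, Matrix.mulVec_mulVec]

/-- Two purifications of the same state differ by a unitary operator on the purifying system. -/
theorem exists_unitary_mul_eq (Φ Ψ : Matrix X Y ℂ) (h : Φᴴ * Φ = Ψᴴ * Ψ) :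
    ∃ V : Matrix X X ℂ, Vᴴ * V = 1 ∧ V * Φ = Ψ := by
  let f := Matrix.toEuclideanLin Φ
  let g := Matrix.toEuclideanLin Ψ
  have hn : ∀ v, ‖f v‖ = ‖g v‖ := fun v => by
    have h1 : inner ℂ (f v) (f v) = inner ℂ (g v) (g v) := by
      rw [inner_toEuclideanLin, inner_toEuclideanLin, h]
    rw [inner_self_eq_norm_sq_to_K, inner_self_eq_norm_sq_to_K] at h1
    norm_cast at h1
    exact (sq_eq_sq₀ (norm_nonneg _) (norm_nonneg _)).1 h1
  have hk : LinearMap.ker f ≤ LinearMap.ker g := fun v hv => by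
    rw [LinearMap.mem_ker] at hv ⊢
    rw [← norm_eq_zero, ← hn, hv, norm_zero]
  -- The map `Φ v ↦ Ψ v` on the range of `Φ`. It is well defined and isometric because `Φ v` and `Ψ
  -- v` have equal norms, and in finite dimension it extends to an isometry of the whole space.
  let l : LinearMap.range f →ₗ[ℂ] EuclideanSpace ℂ X :=
    (LinearMap.ker f).liftQ g hk ∘ₗ f.quotKerEquivRange.symm.toLinearMap
  have hl : ∀ v, l ⟨f v, v, rfl⟩ = g v := fun v => by
    have : f.quotKerEquivRange.symm ⟨f v, v, rfl⟩ = (LinearMap.ker f).mkQ v := by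
      rw [LinearEquiv.symm_apply_eq]
      rfl
    change (LinearMap.ker f).liftQ g hk (f.quotKerEquivRange.symm ⟨f v, v, rfl⟩) = _
    rw [this]
    rfl
  let L : LinearMap.range f →ₗᵢ[ℂ] EuclideanSpace ℂ X := ⟨l, by
    rintro ⟨_, v, rfl⟩
    rw [hl, ← hn]
    rfl⟩
  refine ⟨Matrix.toEuclideanLin.symm L.extend.toLinearMap, ?_, ?_⟩
  · apply Matrix.toEuclideanLin.injective
    refine LinearMap.ext fun w => ext_inner_left ℂ fun v => ?_
    rw [← inner_toEuclideanLin, LinearEquiv.apply_symm_apply]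
    refine (L.extend.inner_map_map v w).trans ?_
    congr 1
    simp [Matrix.toEuclideanLin]
  · apply Matrix.toEuclideanLin.injective
    refine LinearMap.ext fun v => ?_
    have h1 : Matrix.toEuclideanLin (Matrix.toEuclideanLin.symm L.extend.toLinearMap * Φ) v =
        Matrix.toEuclideanLin (Matrix.toEuclideanLin.symm L.extend.toLinearMap) (f v) := by
      simp [f, Matrix.toEuclideanLin, Matrix.toLpLin_apply]
    rw [h1, LinearEquiv.apply_symm_apply]
    exact (L.extend_apply ⟨f v, v, rfl⟩).trans (hl v)

end Uhlmann

/-! ### Local observables and the bias of a set of games. -/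

section LocalOperators

variable {A M B : Type} [Fintype A] [DecidableEq A] [Fintype M] [DecidableEq M]
  [Fintype B] [DecidableEq B]

/-- The product of an operator on Alice's and one on Bob's private register. -/
def localOp (K : Matrix A A ℂ) (L : Matrix B B ℂ) : Matrix (A × M × B) (A × M × B) ℂ :=
  Matrix.of fun x y => if x.2.1 = y.2.1 then K x.1 y.1 * L x.2.2 y.2.2 else 0

theorem localOp_mul (K K' : Matrix A A ℂ) (L L' : Matrix B B ℂ) :
    (localOp (K * K') (L * L') : Matrix (A × M × B) _ ℂ) = localOp K L * localOp K' L' := by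
  ext ⟨a, m, b⟩ ⟨a', m', b'⟩
  simp only [localOp, Matrix.mul_apply, Matrix.of_apply, Fintype.sum_prod_type]
  have h : ∀ a'', ∑ m'', ∑ b'', ((if m = m'' then K a a'' * L b b'' else 0) *
      if m'' = m' then K' a'' a' * L' b'' b' else 0) =
      if m = m' then ∑ b'', K a a'' * L b b'' * (K' a'' a' * L' b'' b') else 0 := fun a'' => by
    rw [Finset.sum_eq_single m]
    · by_cases hm : m = m' <;> simp [hm]
    · intro m'' _ hm
      simp [hm.symm]
    · simp
  simp only [h]
  split_ifs with hm
  · rw [Finset.sum_mul_sum]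
    exact Finset.sum_congr rfl fun _ _ => Finset.sum_congr rfl fun _ _ => by ring
  · exact Finset.sum_const_zero.symm

theorem localOp_conjTranspose (K : Matrix A A ℂ) (L : Matrix B B ℂ) :
    (localOp K L : Matrix (A × M × B) _ ℂ)ᴴ = localOp Kᴴ Lᴴ := by
  ext x y
  simp only [localOp, Matrix.conjTranspose_apply, Matrix.of_apply, @eq_comm _ y.2.1]
  split_ifs <;> simp

theorem localOp_one : (localOp 1 1 : Matrix (A × M × B) _ ℂ) = 1 := by
  ext ⟨a, m, b⟩ ⟨a', m', b'⟩
  simp only [localOp, Matrix.of_apply, Matrix.one_apply, Prod.ext_iff]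
  split_ifs <;> simp_all

theorem localOp_diagonal (d : A → ℂ) (d' : B → ℂ) :
    (localOp (diagonal d) (diagonal d') : Matrix (A × M × B) _ ℂ) =
      diagonal fun x => d x.1 * d' x.2.2 := by
  ext ⟨a, m, b⟩ ⟨a', m', b'⟩
  simp only [localOp, Matrix.of_apply, Matrix.diagonal_apply, Prod.ext_iff]
  split_ifs <;> simp_all

theorem localOp_one_right_mulVec (K : Matrix A A ℂ) (φ : A × M × B → ℂ) (a : A) (m : M) (b : B) :
    (localOp K 1 *ᵥ φ) (a, m, b) = ∑ a', K a a' * φ (a', m, b) := by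
  simp [localOp, Matrix.mulVec, dotProduct, Fintype.sum_prod_type, Matrix.one_apply]

theorem localOp_one_left_mulVec (L : Matrix B B ℂ) (φ : A × M × B → ℂ) (a : A) (m : M) (b : B) :
    (localOp 1 L *ᵥ φ) (a, m, b) = ∑ b', L b b' * φ (a, m, b') := by
  simp [localOp, Matrix.mulVec, dotProduct, Fintype.sum_prod_type, Matrix.one_apply,
    Finset.sum_ite_irrel]

theorem star_mulVec_dotProduct_mulVec {X : Type} [Fintype X] (K L : Matrix X X ℂ) (φ χ : X → ℂ) :
    star (K *ᵥ φ) ⬝ᵥ (L *ᵥ χ) = star φ ⬝ᵥ ((Kᴴ * L) *ᵥ χ) := by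
  rw [Matrix.star_mulVec, ← Matrix.dotProduct_mulVec, Matrix.mulVec_mulVec]

variable {n : ℕ}

/-- The part of the vector `ψ` where the labels of Alice and Bob have given values. -/
def component (x : A → Option (Bits n)) (y : B → Option (Bits n)) (ψ : A × M × B → ℂ)
    (c d : Bits n) : A × M × B → ℂ :=
  fun i => if x i.1 = some c ∧ y i.2.2 = some d then ψ i else 0

/-- The components have disjoint supports. Only an inequality is claimed, because basis states
without a label (Abort) belong to no component. -/
theorem sum_star_component_le (x : A → Option (Bits n)) (y : B → Option (Bits n))
    (ψ : A × M × B → ℂ) :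
    ∑ c, ∑ d, (star (component x y ψ c d) ⬝ᵥ component x y ψ c d).re ≤ (star ψ ⬝ᵥ ψ).re := by
  simp only [dotProduct, Complex.re_sum]
  have h : ∀ i, ∑ c, ∑ d,
      (star (component x y ψ c d) i * component x y ψ c d i).re ≤ (star ψ i * ψ i).re := fun i => by
    have h0 : 0 ≤ (star ψ i * ψ i).re := by
      rw [Pi.star_apply, Complex.star_def, ← Complex.normSq_eq_conj_mul_self, Complex.ofReal_re]
      exact Complex.normSq_nonneg _
    have h1 : ∀ c d, (star (component x y ψ c d) i * component x y ψ c d i).re =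
        if x i.1 = some c then if y i.2.2 = some d then (star ψ i * ψ i).re else 0 else 0 :=
      fun c d => by
        simp only [component, Pi.star_apply, ite_and]
        split_ifs <;> simp
    simp only [h1]
    cases hx : x i.1 <;> cases hy : y i.2.2 <;> simp <;> simpa using h0
  calc _ = ∑ i, ∑ c, ∑ d, (star (component x y ψ c d) i * component x y ψ c d i).re := by
        rw [Finset.sum_comm]
        refine Eq.trans ?_ Finset.sum_comm
        rw [Finset.sum_comm]
        refine Finset.sum_congr rfl fun c _ => ?_
        rw [Finset.sum_comm]
    _ ≤ _ := Finset.sum_le_sum fun i _ => h i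

/-- The bound on the bias of the games in `S`. -/
theorem sum_hadamard_bias_le (x : A → Option (Bits n)) (y : B → Option (Bits n))
    (ψ : A × M × B → ℂ) (hψ : (star ψ ⬝ᵥ ψ).re = 1)
    (V : Bits n → Matrix A A ℂ) (hV : ∀ c, (V c)ᴴ * V c = 1)
    (U : Bits n → Matrix B B ℂ) (hU : ∀ d, (U d)ᴴ * U d = 1)
    (hVU : ∀ c d, localOp (V c) (U d) *ᵥ component x y ψ (fun _ => false) (fun _ => false) = component x y ψ c d)
    (S : Finset (Fin n)) (z : A → ℝ) (hz : ∀ a, z a * z a = 1) (w : B → ℝ)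
    (hw : ∀ b, w b * w b = 1) :
    ∑ c, ∑ d, hadamard S c d * ∑ i, z i.1 * w i.2.2 * Complex.normSq (component x y ψ c d i) ≤
      (√2 / 2) ^ S.card := by
  set ψ₀ := component x y ψ (fun _ => false) (fun _ => false)
  let Z : Matrix A A ℂ := diagonal fun a => (z a : ℂ)
  let W : Matrix B B ℂ := diagonal fun b => (w b : ℂ)
  have hZ : Zᴴ = Z := by
    simp only [Z, Matrix.diagonal_conjTranspose]
    congr 1
    ext a
    simp
  have hW : Wᴴ = W := by
    simp only [W, Matrix.diagonal_conjTranspose]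
    congr 1
    ext a
    simp
  have hZZ : Z * Z = 1 := by
    simp only [Z, Matrix.diagonal_mul_diagonal, ← Complex.ofReal_mul, hz, Complex.ofReal_one,
      Matrix.diagonal_one]
  have hWW : W * W = 1 := by
    simp only [W, Matrix.diagonal_mul_diagonal, ← Complex.ofReal_mul, hw, Complex.ofReal_one,
      Matrix.diagonal_one]
  -- A sign observable conjugated by a unitary is again unitary, hence preserves norms.
  have hsq : ∀ {X : Type} [Fintype X] [DecidableEq X] (T D : Matrix X X ℂ), Tᴴ * T = 1 → Dᴴ = D →
      D * D = 1 → (Tᴴ * D * T)ᴴ * (Tᴴ * D * T) = 1 := fun T D hT hD hDD => by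
    have hT' : T * Tᴴ = 1 := mul_eq_one_comm.1 hT
    simp only [Matrix.conjTranspose_mul, Matrix.conjTranspose_conjTranspose, hD]
    calc Tᴴ * (D * T) * (Tᴴ * D * T) = Tᴴ * D * (T * Tᴴ) * D * T := by
          simp only [Matrix.mul_assoc]
      _ = Tᴴ * (D * D) * T := by rw [hT', Matrix.mul_one]; simp only [Matrix.mul_assoc]
      _ = 1 := by rw [hDD, Matrix.mul_one, hT]
  set N := (star ψ₀ ⬝ᵥ ψ₀).re with hN
  have hNcd : ∀ c d, (star (component x y ψ c d) ⬝ᵥ component x y ψ c d).re = N := fun c d => by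
    rw [← hVU, star_mulVec_dotProduct_mulVec, localOp_conjTranspose, ← localOp_mul, hV, hU,
      localOp_one, Matrix.one_mulVec]
  -- There are `4ⁿ` pairs of labels, and local unitaries give all components the same squared norm
  -- `N`.
  have hN1 : 4 ^ n * N ≤ 1 := by
    have h := sum_star_component_le x y ψ
    simp only [hNcd, Finset.sum_const, Finset.card_univ, nsmul_eq_mul, hψ] at h
    rw [← mul_assoc] at h
    refine le_trans (le_of_eq ?_) h
    congr 1
    simp [← mul_pow]
    norm_num
  -- Tsirelson's vectors: `u c` depends only on Alice's label and `v d` only on Bob's, and their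
  -- inner product is the correlation of the outputs on the component with labels `c`, `d`.
  let u : Bits n → EuclideanSpace ℂ (A × M × B) := fun c =>
    WithLp.toLp 2 (localOp ((V c)ᴴ * Z * V c) 1 *ᵥ ψ₀)
  let v : Bits n → EuclideanSpace ℂ (A × M × B) := fun d =>
    WithLp.toLp 2 (localOp 1 ((U d)ᴴ * W * U d) *ᵥ ψ₀)
  have hnorm : ∀ φ : A × M × B → ℂ, ‖WithLp.toLp 2 φ‖ ^ 2 = (star φ ⬝ᵥ φ).re := fun φ => by
    rw [← inner_self_eq_norm_sq (𝕜 := ℂ), EuclideanSpace.inner_toLp_toLp, dotProduct_comm]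
    rfl
  have hu : ∀ c, ‖u c‖ ^ 2 ≤ N := fun c => by
    rw [hnorm, star_mulVec_dotProduct_mulVec, localOp_conjTranspose, ← localOp_mul,
      hsq _ _ (hV c) hZ hZZ, Matrix.conjTranspose_one, Matrix.mul_one, localOp_one,
      Matrix.one_mulVec]
  have hv : ∀ d, ‖v d‖ ^ 2 ≤ N := fun d => by
    rw [hnorm, star_mulVec_dotProduct_mulVec, localOp_conjTranspose, ← localOp_mul,
      hsq _ _ (hU d) hW hWW, Matrix.conjTranspose_one, Matrix.mul_one, localOp_one,
      Matrix.one_mulVec]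
  -- The Hadamard estimate is real; the real part of the complex inner product serves as the real
  -- one.
  let _ := InnerProductSpace.rclikeToReal ℂ (EuclideanSpace ℂ (A × M × B))
  have hmain := sum_hadamard_inner_le S u v N hu hv
  have hin : ∀ c d, inner ℝ (u c) (v d) =
      ∑ i, z i.1 * w i.2.2 * Complex.normSq (component x y ψ c d i) := fun c d => by
    have h1 : inner ℝ (u c) (v d) = (inner ℂ (u c) (v d)).re := rfl
    have h2 : star (component x y ψ c d) ⬝ᵥ (localOp Z W *ᵥ component x y ψ c d) =
        star (localOp ((V c)ᴴ * Z * V c) 1 *ᵥ ψ₀) ⬝ᵥ (localOp 1 ((U d)ᴴ * W * U d) *ᵥ ψ₀) := by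
      rw [← hVU, Matrix.mulVec_mulVec, star_mulVec_dotProduct_mulVec,
        star_mulVec_dotProduct_mulVec, localOp_conjTranspose, localOp_conjTranspose,
        ← localOp_mul, ← localOp_mul, ← localOp_mul]
      simp only [Matrix.conjTranspose_mul, Matrix.conjTranspose_conjTranspose, hZ,
        Matrix.conjTranspose_one, Matrix.mul_one, Matrix.one_mul, Matrix.mul_assoc]
    rw [h1, EuclideanSpace.inner_toLp_toLp, dotProduct_comm, ← h2, localOp_diagonal, dotProduct,
      Complex.re_sum]
    refine Finset.sum_congr rfl fun i _ => ?_
    rw [Matrix.mulVec_diagonal, Pi.star_apply, Complex.star_def, mul_left_comm,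
      ← Complex.normSq_eq_conj_mul_self, ← Complex.ofReal_mul, ← Complex.ofReal_mul,
      Complex.ofReal_re]
  simp only [hin] at hmain
  refine hmain.trans ?_
  have h0 : (0 : ℝ) ≤ (√2 / 2) ^ S.card := by positivity
  calc 4 ^ n * (√2 / 2) ^ S.card * N = (√2 / 2) ^ S.card * (4 ^ n * N) := by ring
    _ ≤ (√2 / 2) ^ S.card * 1 := mul_le_mul_of_nonneg_left hN1 h0
    _ = _ := mul_one _

end LocalOperators

/-! ### From hidden labels to parallel CHSH games. -/

section Game

variable {A M B : Type} [Fintype A] [DecidableEq A] [Fintype M] [DecidableEq M]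
  [Fintype B] [DecidableEq B] {n : ℕ}

/-- If the state of the other systems does not depend on a label, then the components of a vector
for the values of the label differ by unitary operators on the system that has the label. -/
theorem exists_unitary_label {Y L : Type} [Fintype Y] [DecidableEq Y] [DecidableEq L]
    (x : A → Option L) (Ψ : Matrix A Y ℂ) (c₀ : L)
    (h : ∀ c c' y y', ∑ a with x a = some c, Ψ a y * star (Ψ a y') =
      ∑ a with x a = some c', Ψ a y * star (Ψ a y')) :
    ∃ V : L → Matrix A A ℂ, (∀ c, (V c)ᴴ * V c = 1) ∧ ∀ c y a,
      ∑ a', V c a a' * (if x a' = some c₀ then Ψ a' y else 0) =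
        if x a = some c then Ψ a y else 0 := by
  -- `Φ c` keeps the rows with label `c`. The hypothesis says that `(Φ c)ᴴ * Φ c` is the same for
  -- all `c`, which is the condition of `exists_unitary_mul_eq`.
  let Φ : L → Matrix A Y ℂ := fun c => Matrix.of fun a y => if x a = some c then Ψ a y else 0
  have hΦ : ∀ c y y', ((Φ c)ᴴ * Φ c) y y' = ∑ a with x a = some c, Ψ a y' * star (Ψ a y) :=
    fun c y y' => by
      rw [Matrix.mul_apply, Finset.sum_filter]
      refine Finset.sum_congr rfl fun a _ => ?_
      simp only [Φ, Matrix.conjTranspose_apply, Matrix.of_apply]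
      split_ifs
      · exact mul_comm _ _
      · simp
  have hV : ∀ c, ∃ V : Matrix A A ℂ, Vᴴ * V = 1 ∧ V * Φ c₀ = Φ c := fun c =>
    exists_unitary_mul_eq _ _ (by ext y y'; rw [hΦ, hΦ]; exact h _ _ _ _)
  choose V hV1 hV2 using hV
  exact ⟨V, hV1, fun c y a => congrFun (congrFun (hV2 c) a) y⟩

/-- The probability that all of the parallel CHSH games are won, written with biases. -/
theorem indicator_select_eq (z : Bits n × Bits n) (b w : Bits n) :
    (if w = select z b then (1 : ℝ) else 0) =
      (1 / 2) ^ n * ∑ S : Finset (Fin n), hadamard S (xorBits z) b *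
        ((∏ i ∈ S, bitSign (z.1 i)) * ∏ i ∈ S, bitSign (w i)) := by
  -- A single CHSH game: `w = z_b` is equivalent to `z₀ ⊕ w = (z₀ ⊕ z₁) ∧ b`, and the indicator of
  -- an equality of bits is half of one plus the product of their signs.
  have h : ∀ i, (1 / 2 : ℝ) * (1 + bitSign (xorBits z i && b i) *
      (bitSign (z.1 i) * bitSign (w i))) = if w i = select z b i then 1 else 0 := fun i => by
    have h : ∀ p q r t : Bool, (1 / 2 : ℝ) * (1 + bitSign (xor p q && r) *
        (bitSign p * bitSign t)) = if t = if r then q else p then 1 else 0 := by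
      intro p q r t
      cases p <;> cases q <;> cases r <;> cases t <;> norm_num [bitSign]
    exact (h (z.1 i) (z.2 i) (b i) (w i)).trans (if_congr Iff.rfl rfl rfl)
  have h1 : ∑ S : Finset (Fin n), hadamard S (xorBits z) b *
        ((∏ i ∈ S, bitSign (z.1 i)) * ∏ i ∈ S, bitSign (w i)) =
      ∏ i, (1 + bitSign (xorBits z i && b i) * (bitSign (z.1 i) * bitSign (w i))) := by
    rw [Finset.prod_one_add, Finset.powerset_univ]
    exact Finset.sum_congr rfl fun S _ => by
      rw [hadamard, Finset.prod_mul_distrib, Finset.prod_mul_distrib]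
  rw [h1, show (1 / 2 : ℝ) ^ n = ∏ _i : Fin n, (1 / 2 : ℝ) by simp, ← Finset.prod_mul_distrib]
  simp only [h, Finset.prod_ite_zero, Finset.mem_univ, true_imp_iff, Finset.prod_const_one,
    funext_iff]

/-- The product of the signs of bits of an output, if there is one. -/
def outSign (S : Finset (Fin n)) (o : Option (Bits n)) : ℝ :=
  -- The sign on Abort is arbitrary up to `±1`: those basis states are in no component, and the
  -- square must be `1` for the observable to be unitary.
  o.elim 1 fun z => ∏ i ∈ S, bitSign (z i)

theorem outSign_mul_self (S : Finset (Fin n)) (o : Option (Bits n)) :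
    outSign S o * outSign S o = 1 := by
  cases o with
  | none => simp [outSign]
  | some z =>
    rw [outSign, Option.elim_some, ← Finset.prod_mul_distrib]
    exact Finset.prod_eq_one fun i _ => by cases z i <;> simp [bitSign]

open Classical in
/-- If neither party has information on the label of the other one, then the outputs are
correct with at most the optimal quantum winning probability for parallel CHSH games. -/
theorem sum_correct_le (oA : A → Option (Bits n × Bits n)) (oB : B → Option (Bits n × Bits n))
    (ψ : A × M × B → ℂ) (hψ : (star ψ ⬝ᵥ ψ).re = 1)
    (hA : ∀ c c' m m' b b',
      ∑ a with (oA a).map xorBits = some c, ψ (a, m, b) * star (ψ (a, m', b')) =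
        ∑ a with (oA a).map xorBits = some c', ψ (a, m, b) * star (ψ (a, m', b')))
    (hB : ∀ d d' m m' a a',
      ∑ b with (oB b).map Prod.fst = some d, ψ (a, m, b) * star (ψ (a', m', b)) =
        ∑ b with (oB b).map Prod.fst = some d', ψ (a, m, b) * star (ψ (a', m', b))) :
    ∑ i, (if ∃ z b, oA i.1 = some z ∧ oB i.2.2 = some (b, select z b) then
      Complex.normSq (ψ i) else 0) ≤ (Real.cos (Real.pi / 8) ^ 2) ^ n := by
  set x : A → Option (Bits n) := fun a => (oA a).map xorBits with hx
  set y : B → Option (Bits n) := fun b => (oB b).map Prod.fst with hy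
  obtain ⟨V, hV, hV'⟩ := exists_unitary_label x (Matrix.of fun a (j : M × B) => ψ (a, j))
    (fun _ => false) fun c c' j j' => hA c c' j.1 j'.1 j.2 j'.2
  obtain ⟨U, hU, hU'⟩ := exists_unitary_label y (Matrix.of fun b (j : A × M) => ψ (j.1, j.2, b))
    (fun _ => false) fun d d' j j' => hB d d' j.2 j'.2 j.1 j'.1
  have hVU : ∀ c d, localOp (V c) (U d) *ᵥ component x y ψ (fun _ => false) (fun _ => false) =
      component x y ψ c d := fun c d => by
    -- `U d` was obtained for the whole of `ψ` with Alice's register and the message as spectators,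
    -- so it acts correctly for each value of Alice's label; likewise for `V c` below.
    have h1 : localOp 1 (U d) *ᵥ component x y ψ (fun _ => false) (fun _ => false) =
        component x y ψ (fun _ => false) d := by
      ext ⟨a, m, b⟩
      rw [localOp_one_left_mulVec]
      simp only [component]
      by_cases ha : x a = some fun _ => false
      · simpa [ha] using hU' d (a, m) b
      · simp [ha]
    have h2 : localOp (V c) 1 *ᵥ component x y ψ (fun _ => false) d = component x y ψ c d := by
      ext ⟨a, m, b⟩
      rw [localOp_one_right_mulVec]
      simp only [component]
      by_cases hb : y b = some d
      · simpa [hb] using hV' c (m, b) a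
      · simp [hb]
    rw [← h2, ← h1, Matrix.mulVec_mulVec, ← localOp_mul, Matrix.mul_one, Matrix.one_mul]
  have hi : ∀ i, (if ∃ z b, oA i.1 = some z ∧ oB i.2.2 = some (b, select z b) then
      Complex.normSq (ψ i) else 0) = (1 / 2) ^ n * ∑ S : Finset (Fin n), ∑ c, ∑ d,
        hadamard S c d * (outSign S ((oA i.1).map Prod.fst) * outSign S ((oB i.2.2).map Prod.snd) *
          Complex.normSq (component x y ψ c d i)) := fun i => by
    have hcd : ∀ c d, Complex.normSq (component x y ψ c d i) =
        if x i.1 = some c then if y i.2.2 = some d then Complex.normSq (ψ i) else 0 else 0 :=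
      fun c d => by
        simp only [component, ite_and]
        split_ifs <;> simp
    simp only [hcd]
    cases ha : oA i.1 with
    | none => simp [hx, ha]
    | some z =>
      cases hb : oB i.2.2 with
      | none => simp [hy, hb]
      | some bw =>
        obtain ⟨b, w⟩ := bw
        have h1 : (∃ z' b', some z = some z' ∧ some (b, w) = some (b', select z' b')) ↔
            w = select z b := by
          constructor
          · rintro ⟨z', b', hz, hb'⟩
            cases hz
            cases hb'
            rfl
          · rintro rfl
            exact ⟨z, b, rfl, rfl⟩
        have h2 := indicator_select_eq z b w
        have h3 : ∀ S : Finset (Fin n), ∑ c, ∑ d, hadamard S c d *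
            (outSign S ((some z).map Prod.fst) * outSign S ((some (b, w)).map Prod.snd) *
              if x i.1 = some c then if y i.2.2 = some d then Complex.normSq (ψ i) else 0 else 0) =
            hadamard S (xorBits z) b * ((∏ i ∈ S, bitSign (z.1 i)) * ∏ i ∈ S, bitSign (w i)) *
              Complex.normSq (ψ i) := fun S => by
          rw [Finset.sum_eq_single (xorBits z), Finset.sum_eq_single b]
          · simp only [hx, hy, ha, hb, Option.map_some, if_true, outSign, Option.elim_some]
            ring
          · intro d _ hd
            simp [hy, hb, hd.symm]
          · simp
          · intro c _ hc
            simp [hx, ha, hc.symm]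
          · simp
        simp only [h3, h1]
        rw [← Finset.sum_mul, ← mul_assoc, ← h2]
        split_ifs <;> simp
  simp only [hi]
  rw [← Finset.mul_sum, Finset.sum_comm]
  have hS : ∀ S : Finset (Fin n), ∑ i, ∑ c, ∑ d,
        hadamard S c d * (outSign S ((oA i.1).map Prod.fst) * outSign S ((oB i.2.2).map Prod.snd) *
          Complex.normSq (component x y ψ c d i)) ≤ (√2 / 2) ^ S.card := fun S => by
    have h := sum_hadamard_bias_le x y ψ hψ V hV U hU hVU S
      (fun a => outSign S ((oA a).map Prod.fst)) (fun a => outSign_mul_self _ _)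
      (fun b => outSign S ((oB b).map Prod.snd)) (fun b => outSign_mul_self _ _)
    refine le_trans (le_of_eq ?_) h
    rw [Finset.sum_comm]
    refine Finset.sum_congr rfl fun c _ => ?_
    rw [Finset.sum_comm]
    refine Finset.sum_congr rfl fun d _ => ?_
    rw [Finset.mul_sum]
  -- The sum over subsets is the expansion of `(1 + √2/2)ⁿ`, and `(1 + √2/2)/2` equals `cos²(π/8)`
  -- by the half-angle formula.
  calc _ ≤ (1 / 2 : ℝ) ^ n * ∑ S : Finset (Fin n), (√2 / 2) ^ S.card :=
        mul_le_mul_of_nonneg_left (Finset.sum_le_sum fun S _ => hS S) (by positivity)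
    _ = (1 / 2 : ℝ) ^ n * (1 + √2 / 2) ^ n := by
        congr 1
        have h := Finset.prod_one_add (f := fun _ : Fin n => √2 / 2) Finset.univ
        simp only [Finset.prod_const, Finset.card_univ, Fintype.card_fin,
          Finset.powerset_univ] at h
        exact h.symm
    _ = _ := by
        rw [← mul_pow]
        congr 1
        rw [Real.cos_sq, show 2 * (Real.pi / 8) = Real.pi / 4 by ring, Real.cos_pi_div_four]
        ring

end Game

/-! ### The upper bound for weakly secure protocols. -/

namespace Protocol

variable {n : ℕ}

theorem prob_eq_re_sum {A M B : Type} [Fintype A] [Fintype M] [Fintype B]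
    (ρ : Matrix (A × M × B) (A × M × B) ℂ) (E : Set (A × M × B)) [DecidablePred (· ∈ E)] :
    prob ρ E = (∑ a, ∑ m, ∑ b, if (a, m, b) ∈ E then ρ (a, m, b) (a, m, b) else 0).re := by
  simp only [prob, Fintype.sum_prod_type, Complex.re_sum, Set.indicator_apply]
  refine Finset.sum_congr rfl fun a _ => Finset.sum_congr rfl fun m _ =>
    Finset.sum_congr rfl fun b _ => ?_
  split_ifs <;> rfl

open Classical in
theorem prob_of_pure_bob {M : Type} [Fintype M] [DecidableEq M] {m₀ : M} {α σ σ' : Strategy M}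
    {f : σ'.S → σ.S} {t : ℕ}
    (h : ∀ (p : σ.S → Prop) [DecidablePred p] (a a' : α.S) (m m' : M),
      ∑ s with p s, jointState m₀ α σ t (a, m, s) (a', m', s) =
        ∑ s with p (f s), jointState m₀ α σ' t (a, m, s) (a', m', s))
    (E : α.S → σ.S → Prop) :
    prob (jointState m₀ α σ t) {x | E x.1 x.2.2} =
      prob (jointState m₀ α σ' t) {x | E x.1 (f x.2.2)} := by
  rw [prob_eq_re_sum, prob_eq_re_sum]
  refine congrArg Complex.re (Finset.sum_congr rfl fun a _ => Finset.sum_congr rfl fun m _ => ?_)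
  have h' := h (fun s => E a s) a a m m
  rw [Finset.sum_filter, Finset.sum_filter] at h'
  exact h'

open Classical in
theorem prob_of_pure_alice {M : Type} [Fintype M] [DecidableEq M] {m₀ : M} {β σ σ' : Strategy M}
    {f : σ'.S → σ.S} {t : ℕ}
    (h : ∀ (p : σ.S → Prop) [DecidablePred p] (b b' : β.S) (m m' : M),
      ∑ s with p s, jointState m₀ σ β t (s, m, b) (s, m', b') =
        ∑ s with p (f s), jointState m₀ σ' β t (s, m, b) (s, m', b'))
    (E : σ.S → β.S → Prop) :
    prob (jointState m₀ σ β t) {x | E x.1 x.2.2} =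
      prob (jointState m₀ σ' β t) {x | E (f x.1) x.2.2} := by
  rw [prob_eq_re_sum, prob_eq_re_sum]
  have hc : ∀ {S : Type} [Fintype S] (F : S → M → β.S → ℂ),
      ∑ a, ∑ m, ∑ b, F a m b = ∑ m, ∑ b, ∑ a, F a m b := fun F => by
    rw [Finset.sum_comm]
    exact Finset.sum_congr rfl fun m _ => Finset.sum_comm
  rw [hc, hc]
  refine congrArg Complex.re (Finset.sum_congr rfl fun m _ => Finset.sum_congr rfl fun b _ => ?_)
  have h' := h (fun s => E s b) b b m m
  rw [Finset.sum_filter, Finset.sum_filter] at h'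
  exact h'

theorem IsOT.le_of_isWeaklySecure {P : Protocol n} {p : ℝ} (hP : P.IsOT p)
    (hs : P.IsWeaklySecure) : p ≤ (Real.cos (Real.pi / 8) ^ 2) ^ n := by
  classical
  obtain ⟨β, g, hβ, hg⟩ := exists_pure_bob P.m₀ P.bob P.rounds
  obtain ⟨α, f, hα, hf⟩ := exists_pure_alice P.m₀ P.alice P.rounds
  obtain ⟨ψ, hψ⟩ := jointState_pure P.m₀ α β P.rounds hα hβ
  have happ : ∀ i j, jointState P.m₀ α β P.rounds i j = ψ i * star (ψ j) := fun i j => by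
    rw [hψ, vecMulVec_apply, Pi.star_apply]
  have h1 : (star ψ ⬝ᵥ ψ).re = 1 := by
    have h := trace_jointState P.m₀ α β P.rounds
    rw [hψ, Matrix.trace_vecMulVec, dotProduct_comm] at h
    rw [h, Complex.one_re]
  -- Purified Alice is indistinguishable from honest Alice for Bob, so he does not abort, and weak
  -- security covers her.
  have hA : prob (P.final α P.bob) {x | P.bobOut x.2.2 = none} = 0 := by
    rw [← hP.bob_no_abort]
    exact (prob_of_pure_alice (hf P.bob P.rounds) fun _ s => P.bobOut s = none).symm
  have hB : prob (P.final P.alice β) {x | P.aliceOut x.1 = none} = 0 := by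
    rw [← hP.alice_no_abort]
    exact (prob_of_pure_bob (hg P.alice P.rounds) fun s _ => P.aliceOut s = none).symm
  have hcorrect : p = ∑ i, if ∃ z b, P.aliceOut (f i.1) = some z ∧
      P.bobOut (g i.2.2) = some (b, select z b) then Complex.normSq (ψ i) else 0 := by
    rw [← hP.correct]
    refine (prob_of_pure_alice (hf P.bob P.rounds) fun a s => ∃ z b, P.aliceOut a = some z ∧
      P.bobOut s = some (b, select z b)).trans ?_
    refine (prob_of_pure_bob (hg α P.rounds) fun a s => ∃ z b, P.aliceOut (f a) = some z ∧
      P.bobOut s = some (b, select z b)).trans ?_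
    rw [prob]
    refine Finset.sum_congr rfl fun i _ => ?_
    rw [Set.indicator_apply]
    refine if_congr Iff.rfl ?_ rfl
    rw [happ, Complex.star_def, Complex.mul_conj, Complex.ofReal_re]
  rw [hcorrect]
  refine sum_correct_le (fun a => P.aliceOut (f a)) (fun s => P.bobOut (g s)) ψ h1 ?_ ?_
  · intro c c' m m' b b'
    have h := congrFun (congrFun (hs.against_bob β hB c c') (b, m)) (b', m')
    simp only [bobView, Matrix.of_apply, final] at h
    -- Security concerns purified Bob against the given Alice. Her purification leaves his view
    -- unchanged, which turns the statement into one about `ψ`.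
    have h2 : ∀ c, _ := fun c => hf β P.rounds (fun s => (P.aliceOut s).map xorBits = some c)
      b b' m m'
    simp only [happ] at h2
    rw [← h2, ← h2]
    convert h
  · intro d d' m m' a a'
    have h := congrFun (congrFun (hs.against_alice α hA d d') (a, m)) (a', m')
    simp only [aliceView, Matrix.of_apply, final] at h
    have h2 : ∀ d, _ := fun d => hg α P.rounds (fun s => (P.bobOut s).map Prod.fst = some d)
      a a' m m'
    simp only [happ] at h2
    rw [← h2, ← h2]
    convert h

end Protocol

end QOT

theorem mainTheorem8 (n : ℕ) :
    (∀ (P : QOT.Protocol n) (p : ℝ), P.IsOT p → P.IsWeaklySecure →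
      p ≤ (Real.cos (Real.pi / 8) ^ 2) ^ n) ∧
    (∃ P : QOT.Protocol 1, P.IsOT (Real.cos (Real.pi / 8) ^ 2) ∧ P.IsSecure) ∧
    (∀ P : QOT.Protocol 1, P.IsOT (Real.cos (Real.pi / 8) ^ 2) → P.IsSecure →
      (P.pow n).IsOT ((Real.cos (Real.pi / 8) ^ 2) ^ n) ∧ (P.pow n).IsSecure) :=
  ⟨fun _ _ hP hs => hP.le_of_isWeaklySecure hs,
    ⟨QOT.codeProtocol, QOT.codeProtocol_isOT, QOT.codeProtocol_isSecure⟩,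
    fun _ hP hs => ⟨hP.pow n, hs.pow n⟩⟩
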